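/- Let $p_0=(0,0)$, $p_1=(1,0)$, $p_2=(\tfrac12,\tfrac{\sqrt3}2)$ in $\mathbb R^2$, let $f_i(x)=(x+p_i)/2$ for $i=0,1,2$, and let $K$ be the Sierpiński gasket, i.e. the unique non-empty compact set with $K=f_0(K)\cup f_1(K)\cup f_2(K)$. Let $\alpha=\log 3/\log 2$, $\beta^*=\log 5/\log 2$, and let $\nu$ be the normalized ($\alpha$-dimensional) Hausdorff measure on $K$. For a word $w=w_1\ldots w_n\in W_n=\{0,1,2\}^n$ put $V_w=f_{w_1}\circ\cdots\circ f_{w_n}(\{p_0,p_1,p_2\})$. For continuous $u:K\to\mathbb R$ and $\beta\in(\alpha,\beta^*)$ define, with values in $[0,+\infty]$, $$E_\beta(u,u)=\sum_{n=1}^\infty 2^{(\beta-\alpha)n}\sum_{w\in W_n}\sum_{p,q\in V_w}(u(p)-u(q))^2,\qquad \mathcal E_{\mathrm{loc}}(u,u)=\lim_{n\to\infty}\Big(\frac53\Big)^n\sum_{w\in W_n}\sum_{p,q\in V_w}(u(p)-u(q))^2 .$$ Extend both energies to $u\in L^2(K;\nu)$ by evaluating them at the (unique) continuous version of $u$ if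 there is one, and by $+\infty$ otherwise. Let $(\beta_n)$ be a sequence in $(\alpha,\beta^*)$ that increases to $\beta^*$, and set $\mathcal E^n=(5\cdot 2^{-\beta_n}-1)E_{\beta_n}$. Then $\mathcal E^n$ converges to $\mathcal E_{\mathrm{loc}}$ in the sense of Mosco on $L^2(K;\nu)$. That is, all $\mathcal E^n$ and $\mathcal E_{\mathrm{loc}}$ are closed forms on $L^2(K;\nu)$ (non-negative symmetric bilinear forms on linear subspaces, extended by $+\infty$ outside these subspaces, which are complete for the norm $(\mathcal E(u,u)+\|u\|_{L^2}^2)^{1/2}$), and 1. for every sequence $(u_n)$ in $L^2(K;\nu)$ converging weakly to $u\in L^2(K;\nu)$, $$\liminf_{n\to\infty}\mathcal E^n(u_n,u_n)\ \ge\ \mathcal E_{\mathrm{loc}}(u,u);$$ 2. for every $u\in L^2(K;\nu)$ there is a sequence $(u_n)$ in $L^2(K;\nu)$ converging strongly to $u$ with $$\limsup_{n\to\infty}\mathcal E^n(u_n,u_n)\ \le\ \mathcal E_{\mathrm{loc}}(u,u).$$ -/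

import Mathlib

open MeasureTheory Filter Topology
open scoped ENNReal

noncomputable section

namespace SierpinskiGasket

/-! ### The Sierpinski gasket -/

/-- The Euclidean plane `ℝ²`. -/
abbrev Plane : Type := EuclideanSpace ℝ (Fin 2)

/-- The points `p₀ = (0,0)`, `p₁ = (1,0)`, `p₂ = (1/2, √3/2)`. -/
def corner : Fin 3 → Plane :=
  ![!₂[0, 0], !₂[1, 0], !₂[1 / 2, √3 / 2]]

/-- The contractions `f_i(x) = (x + p_i)/2`. -/
def contr (i : Fin 3) (x : Plane) : Plane := (1 / 2 : ℝ) • (x + corner i)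

/-- `V₀ = {p₀,p₁,p₂}` and `V_{n+1} = f₀(V_n) ∪ f₁(V_n) ∪ f₂(V_n)`. -/
def vertexSet : ℕ → Set Plane
  | 0 => Set.range corner
  | n + 1 => ⋃ i : Fin 3, contr i '' vertexSet n

/-- The Sierpinski gasket, the closure of `⋃ V_n`. By `gasket_nonempty`, `isCompact_gasket`,
`gasket_eq_iUnion` and `eq_gasket` below it is the unique non-empty compact set `K` with
`K = f₀(K) ∪ f₁(K) ∪ f₂(K)`. -/
def gasket : Set Plane := closure (⋃ n : ℕ, vertexSet n)

lemma contr_corner (i : Fin 3) : contr i (corner i) = corner i := by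
  rw [contr, ← two_smul ℝ, smul_smul]; norm_num

lemma dist_contr (i : Fin 3) (x y : Plane) : dist (contr i x) (contr i y) = (1 / 2) * dist x y := by
  rw [contr, contr, dist_smul₀, dist_add_right]; norm_num

lemma continuous_contr (i : Fin 3) : Continuous (contr i) := by
  unfold contr; fun_prop

lemma norm_corner_le (i : Fin 3) : ‖corner i‖ ≤ 1 := by
  have h : ‖corner i‖ ^ 2 ≤ 1 := by
    rw [EuclideanSpace.norm_sq_eq]
    fin_cases i <;> simp [corner, div_pow]
    norm_num
  nlinarith [norm_nonneg (corner i)]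

lemma norm_le_of_mem_vertexSet (n : ℕ) : ∀ x ∈ vertexSet n, ‖x‖ ≤ 1 := by
  induction n with
  | zero => rintro _ ⟨i, rfl⟩; exact norm_corner_le i
  | succ n ih =>
    intro x hx
    obtain ⟨i, y, hy, rfl⟩ := Set.mem_iUnion.1 hx
    have h1 := norm_add_le y (corner i)
    have h2 := ih y hy
    have h3 := norm_corner_le i
    rw [contr, norm_smul]
    norm_num
    linarith

lemma gasket_nonempty : gasket.Nonempty :=
  ⟨corner 0, subset_closure (Set.mem_iUnion.2 ⟨0, ⟨0, rfl⟩⟩)⟩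

lemma isCompact_gasket : IsCompact gasket := by
  refine Metric.isCompact_of_isClosed_isBounded isClosed_closure (Bornology.IsBounded.closure ?_)
  refine Metric.isBounded_closedBall (x := (0 : Plane)) (r := 1) |>.subset ?_
  intro x hx
  obtain ⟨n, hn⟩ := Set.mem_iUnion.1 hx
  simpa using norm_le_of_mem_vertexSet n x hn

lemma iUnion_vertexSet :
    (⋃ n : ℕ, vertexSet n) = ⋃ i : Fin 3, contr i '' (⋃ n : ℕ, vertexSet n) := by
  ext x
  simp only [Set.mem_iUnion, Set.mem_image]
  constructor
  · rintro ⟨n, hn⟩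
    cases n with
    | zero =>
      obtain ⟨i, rfl⟩ := hn
      exact ⟨i, corner i, ⟨0, ⟨i, rfl⟩⟩, contr_corner i⟩
    | succ n =>
      obtain ⟨i, y, hy, rfl⟩ := Set.mem_iUnion.1 hn
      exact ⟨i, y, ⟨n, hy⟩, rfl⟩
  · rintro ⟨i, y, ⟨n, hy⟩, rfl⟩
    exact ⟨n + 1, Set.mem_iUnion.2 ⟨i, y, hy, rfl⟩⟩

lemma gasket_eq_iUnion : gasket = ⋃ i : Fin 3, contr i '' gasket := by
  apply Set.Subset.antisymm
  · refine closure_minimal ?_ ?_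
    · rw [iUnion_vertexSet]
      exact Set.iUnion_mono fun i => Set.image_mono subset_closure
    · exact isClosed_iUnion_of_finite fun i =>
        (isCompact_gasket.image (continuous_contr i)).isClosed
  · refine Set.iUnion_subset fun i => ?_
    refine (image_closure_subset_closure_image (continuous_contr i)).trans (closure_mono ?_)
    conv_rhs => rw [iUnion_vertexSet]
    exact Set.subset_iUnion (fun i => contr i '' (⋃ n : ℕ, vertexSet n)) i

lemma contr_mem_gasket (i : Fin 3) {x : Plane} (hx : x ∈ gasket) : contr i x ∈ gasket := by
  rw [gasket_eq_iUnion]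
  exact Set.mem_iUnion.2 ⟨i, x, hx, rfl⟩

lemma corner_mem_gasket (i : Fin 3) : corner i ∈ gasket :=
  subset_closure (Set.mem_iUnion.2 ⟨0, ⟨i, rfl⟩⟩)

lemma eq_gasket {A : Set Plane} (hne : A.Nonempty) (hc : IsCompact A)
    (hA : A = ⋃ i : Fin 3, contr i '' A) : A = gasket := by
  have hmap : ∀ i, ∀ x ∈ A, contr i x ∈ A := fun i x hx => by
    rw [hA]; exact Set.mem_iUnion.2 ⟨i, x, hx, rfl⟩
  have hlim : Tendsto (fun n : ℕ => (1 / 2 : ℝ) ^ n) atTop (𝓝 0) :=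
    tendsto_pow_atTop_nhds_zero_of_lt_one (by norm_num) (by norm_num)
  apply Set.Subset.antisymm
  · obtain ⟨C, hC⟩ : ∃ C, ∀ a ∈ A, Metric.infDist a gasket ≤ C := by
      obtain ⟨C, hC⟩ := (hc.image (Metric.continuous_infDist_pt gasket)).bddAbove
      exact ⟨C, fun a ha => hC ⟨a, ha, rfl⟩⟩
    have key : ∀ n : ℕ, ∀ a ∈ A, Metric.infDist a gasket ≤ (1 / 2) ^ n * C := by
      intro n
      induction n with
      | zero => simpa using hC
      | succ n ih =>
        intro a ha
        rw [hA] at ha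
        obtain ⟨i, b, hb, rfl⟩ := Set.mem_iUnion.1 ha
        obtain ⟨y, hy, hby⟩ := isCompact_gasket.exists_infDist_eq_dist gasket_nonempty b
        calc Metric.infDist (contr i b) gasket ≤ dist (contr i b) (contr i y) :=
              Metric.infDist_le_dist_of_mem (contr_mem_gasket i hy)
          _ = (1 / 2) * Metric.infDist b gasket := by rw [dist_contr, hby]
          _ ≤ (1 / 2) * ((1 / 2) ^ n * C) := by gcongr; exact ih b hb
          _ = (1 / 2) ^ (n + 1) * C := by ring
    intro a ha
    have h0 : Metric.infDist a gasket ≤ 0 := by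
      have hC0 : Tendsto (fun n : ℕ => (1 / 2 : ℝ) ^ n * C) atTop (𝓝 0) := by
        have := hlim.mul_const C
        rwa [zero_mul] at this
      exact ge_of_tendsto' hC0 fun n => key n a ha
    exact (isClosed_closure.mem_iff_infDist_zero gasket_nonempty).2
      (le_antisymm h0 Metric.infDist_nonneg)
  · obtain ⟨a, ha⟩ := hne
    have hcorner : ∀ i, corner i ∈ A := by
      intro i
      have hmem : ∀ n : ℕ, (contr i)^[n] a ∈ A := by
        intro n
        induction n with
        | zero => exact ha
        | succ n ih => rw [Function.iterate_succ_apply']; exact hmap i _ ih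
      have hd : ∀ n : ℕ, dist ((contr i)^[n] a) (corner i) = (1 / 2) ^ n * dist a (corner i) := by
        intro n
        induction n with
        | zero => simp
        | succ n ih =>
          rw [Function.iterate_succ_apply']
          nth_rewrite 1 [← contr_corner i]
          rw [dist_contr, ih]; ring
      refine hc.isClosed.mem_of_tendsto (f := fun n : ℕ => (contr i)^[n] a) (b := atTop) ?_
        (Eventually.of_forall hmem)
      rw [tendsto_iff_dist_tendsto_zero]
      simp only [hd]
      simpa using hlim.mul_const (dist a (corner i))
    refine closure_minimal (Set.iUnion_subset fun n => ?_) hc.isClosed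
    induction n with
    | zero => rintro _ ⟨i, rfl⟩; exact hcorner i
    | succ n ih =>
      intro x hx
      obtain ⟨i, y, hy, rfl⟩ := Set.mem_iUnion.1 hx
      exact hmap i y (ih hy)

/-- The Sierpinski gasket as a (compact metric) space. -/
abbrev SG : Type := ↥gasket

instance : CompactSpace SG := isCompact_iff_compactSpace.1 isCompact_gasket

/-- The points `p_i` as points of the gasket. -/
def sgCorner (i : Fin 3) : SG := ⟨corner i, corner_mem_gasket i⟩

/-- The maps `f_i` as self-maps of the gasket. -/
def sgContr (i : Fin 3) (x : SG) : SG := ⟨contr i x, contr_mem_gasket i x.2⟩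

/-- For a word `w = w₁ … w_n`, the composition `f_{w₁} ∘ ⋯ ∘ f_{w_n}`. -/
def wordMap : (n : ℕ) → (Fin n → Fin 3) → SG → SG
  | 0, _ => id
  | n + 1, w => sgContr (w 0) ∘ wordMap n (Fin.tail w)

open Classical in
/-- `V_w = f_{w₁} ∘ ⋯ ∘ f_{w_n} (V₀)`. -/
def cellVertices (n : ℕ) (w : Fin n → Fin 3) : Finset SG :=
  Finset.univ.image fun i : Fin 3 => wordMap n w (sgCorner i)

/-! ### Measure and exponents -/

/-- The Hausdorff dimension `α = log 3 / log 2`. -/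
def hausdorffDim : ℝ := Real.log 3 / Real.log 2

/-- The walk dimension `β* = log 5 / log 2`. -/
def walkDim : ℝ := Real.log 5 / Real.log 2

/-- The normalized `α`-dimensional Hausdorff measure `ν` on the gasket. -/
def sgMeasure : Measure SG :=
  (Measure.hausdorffMeasure hausdorffDim (Set.univ : Set SG))⁻¹ •
    Measure.hausdorffMeasure hausdorffDim

/-- The Hilbert space `L²(K; ν)`. -/
abbrev SGL2 : Type := Lp ℝ 2 sgMeasure

/-! ### The energies -/

/-- `∑_{w ∈ W_n} ∑_{p,q ∈ V_w} (u(p) - u(q))²`. -/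
def levelSum (n : ℕ) (u : C(SG, ℝ)) : ℝ :=
  ∑ w : Fin n → Fin 3, ∑ p ∈ cellVertices n w, ∑ q ∈ cellVertices n w, (u p - u q) ^ 2

/-- `E_β(u,u) = ∑_{n ≥ 1} 2^{(β-α)n} ∑_{w ∈ W_n} ∑_{p,q ∈ V_w} (u(p) - u(q))²`, with values in
`[0,∞]`, for continuous `u`. -/
def energyC (β : ℝ) (u : C(SG, ℝ)) : ℝ≥0∞ :=
  ∑' n : ℕ, ENNReal.ofReal
    ((2 : ℝ) ^ ((β - hausdorffDim) * ((n + 1 : ℕ) : ℝ)) * levelSum (n + 1) u)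

/-- `𝓔_loc(u,u) = lim_{n → ∞} (5/3)^n ∑_{w ∈ W_n} ∑_{p,q ∈ V_w} (u(p) - u(q))²`, with values in
`[0,∞]`, for continuous `u`. The limit exists by `tendsto_localEnergyC`. -/
def localEnergyC (u : C(SG, ℝ)) : ℝ≥0∞ :=
  limUnder atTop fun n : ℕ => ENNReal.ofReal ((5 / 3 : ℝ) ^ n * levelSum n u)

open Classical in
/-- Extension of an energy from `C(K)` to `L²(K; ν)`: the energy of the continuous version if there
is one, and `+∞` otherwise. -/
def extendToL2 (E : C(SG, ℝ) → ℝ≥0∞) (u : SGL2) : ℝ≥0∞ :=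
  if h : ∃ v : C(SG, ℝ), ⇑u =ᵐ[sgMeasure] ⇑v then E h.choose else ⊤

/-- `E_β` on `L²(K; ν)`. -/
def energy (β : ℝ) : SGL2 → ℝ≥0∞ := extendToL2 (energyC β)

/-- `𝓔_loc` on `L²(K; ν)`. -/
def localEnergy : SGL2 → ℝ≥0∞ := extendToL2 localEnergyC

lemma corner_injective : Function.Injective corner := by
  have h01 : corner 0 ≠ corner 1 := fun h => by
    simpa [corner] using congrArg (fun x : Plane => x 0) h
  have h02 : corner 0 ≠ corner 2 := fun h => by
    simpa [corner] using congrArg (fun x : Plane => x 0) h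
  have h12 : corner 1 ≠ corner 2 := fun h => by
    have := congrArg (fun x : Plane => x 0) h
    simp [corner] at this
  intro i j h
  fin_cases i <;> fin_cases j <;> first | rfl | (exfalso; first
    | exact h01 h | exact h01 h.symm | exact h02 h | exact h02 h.symm
    | exact h12 h | exact h12 h.symm)

lemma sgContr_injective (i : Fin 3) : Function.Injective (sgContr i) := by
  intro x y h
  have h1 := dist_contr i x.1 y.1
  rw [show contr i x.1 = contr i y.1 from congrArg Subtype.val h, dist_self] at h1
  exact Subtype.ext (dist_eq_zero.1 (by linarith))

lemma wordMap_injective (n : ℕ) (w : Fin n → Fin 3) : Function.Injective (wordMap n w) := by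
  induction n with
  | zero => exact Function.injective_id
  | succ n ih => exact (sgContr_injective _).comp (ih _)

lemma sum_cellVertices (n : ℕ) (w : Fin n → Fin 3) (g : SG → ℝ) :
    ∑ p ∈ cellVertices n w, g p = ∑ i : Fin 3, g (wordMap n w (sgCorner i)) := by
  classical
  unfold cellVertices
  rw [Finset.sum_image]
  · intro i _ j _ h
    exact corner_injective (congrArg Subtype.val (wordMap_injective n w h))

lemma levelSum_eq (n : ℕ) (u : C(SG, ℝ)) :
    levelSum n u = ∑ w : Fin n → Fin 3, ∑ i : Fin 3, ∑ j : Fin 3,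
      (u (wordMap n w (sgCorner i)) - u (wordMap n w (sgCorner j))) ^ 2 := by
  simp only [levelSum, sum_cellVertices]

lemma wordMap_snoc (n : ℕ) (w : Fin n → Fin 3) (i : Fin 3) (x : SG) :
    wordMap (n + 1) (Fin.snoc w i) x = wordMap n w (sgContr i x) := by
  induction n with
  | zero => rfl
  | succ n ih =>
    have h0 : (Fin.snoc w i : Fin (n + 2) → Fin 3) 0 = w 0 := by
      exact Fin.snoc_castSucc (α := fun _ => Fin 3) i w 0
    have ht : Fin.tail (Fin.snoc w i : Fin (n + 2) → Fin 3) = Fin.snoc (Fin.tail w) i := by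
      funext k
      refine Fin.lastCases ?_ (fun k => ?_) k
      · rw [Fin.tail, Fin.succ_last, Fin.snoc_last, Fin.snoc_last]
      · rw [Fin.tail, Fin.succ_castSucc, Fin.snoc_castSucc, Fin.snoc_castSucc, Fin.tail]
    rw [wordMap, h0, ht, Function.comp_apply, ih]
    rfl

lemma sgContr_corner (i : Fin 3) : sgContr i (sgCorner i) = sgCorner i :=
  Subtype.ext (contr_corner i)

lemma sgContr_comm (i j : Fin 3) : sgContr i (sgCorner j) = sgContr j (sgCorner i) :=
  Subtype.ext (by simp only [sgContr, sgCorner, contr, add_comm])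

/-- The rescaled energies of a continuous function are non-decreasing in the level. -/
lemma monotone_rescaled_levelSum (u : C(SG, ℝ)) :
    Monotone fun n : ℕ => (5 / 3 : ℝ) ^ n * levelSum n u := by
  refine monotone_nat_of_le_succ fun n => ?_
  rw [pow_succ, mul_assoc]
  refine mul_le_mul_of_nonneg_left ?_ (by positivity)
  rw [levelSum_eq, levelSum_eq, ← (Fin.snocEquiv fun _ : Fin (n + 1) => Fin 3).sum_comp,
    Fintype.sum_prod_type_right, Finset.mul_sum]
  refine Finset.sum_le_sum fun w _ => ?_
  have hs : ∀ i : Fin 3, (Fin.snocEquiv fun _ : Fin (n + 1) => Fin 3) (i, w) = Fin.snoc w i :=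
    fun _ => rfl
  simp only [hs, wordMap_snoc, Fin.sum_univ_three, sgContr_corner,
    sgContr_comm 1 0, sgContr_comm 2 0, sgContr_comm 2 1]
  generalize u (wordMap n w (sgCorner 0)) = a
  generalize u (wordMap n w (sgCorner 1)) = b
  generalize u (wordMap n w (sgCorner 2)) = c
  generalize u (wordMap n w (sgContr 0 (sgCorner 1))) = x
  generalize u (wordMap n w (sgContr 0 (sgCorner 2))) = y
  generalize u (wordMap n w (sgContr 1 (sgCorner 2))) = z
  nlinarith [sq_nonneg (5 * x - (2 * a + 2 * b + c)), sq_nonneg (5 * y - (2 * a + b + 2 * c)),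
    sq_nonneg (5 * z - (a + 2 * b + 2 * c)),
    sq_nonneg ((5 * x - (2 * a + 2 * b + c)) - (5 * y - (2 * a + b + 2 * c))),
    sq_nonneg ((5 * x - (2 * a + 2 * b + c)) - (5 * z - (a + 2 * b + 2 * c))),
    sq_nonneg ((5 * y - (2 * a + b + 2 * c)) - (5 * z - (a + 2 * b + 2 * c)))]

/-- The limit defining `𝓔_loc(u,u)` exists in `[0,∞]`. -/
lemma tendsto_localEnergyC (u : C(SG, ℝ)) :
    Tendsto (fun n : ℕ => ENNReal.ofReal ((5 / 3 : ℝ) ^ n * levelSum n u)) atTop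
      (𝓝 (localEnergyC u)) :=
  tendsto_nhds_limUnder ⟨_, tendsto_atTop_iSup
    (ENNReal.ofReal_mono.comp (monotone_rescaled_levelSum u))⟩

/-! ### Closed forms and Mosco convergence -/

section Mosco

variable {H : Type*} [NormedAddCommGroup H] [InnerProductSpace ℝ H]

/-- `E : H → [0,∞]` is (the diagonal of) a closed form on `H`, extended by `+∞`: there are a linear
subspace `D` of `H` and a symmetric non-negative bilinear form `B` on `D` such that
`E(u) = B(u,u)` on `D`, `E = +∞` outside `D`, and `D` is complete for the norm
`(B(u,u) + ‖u‖²)^{1/2}`. -/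
def IsClosedForm (E : H → ℝ≥0∞) : Prop :=
  ∃ (D : Submodule ℝ H) (B : D →ₗ[ℝ] D →ₗ[ℝ] ℝ),
    (∀ u v : D, B u v = B v u) ∧
    (∀ u : D, 0 ≤ B u u) ∧
    (∀ u : D, E u = ENNReal.ofReal (B u u)) ∧
    (∀ u : H, u ∉ D → E u = ⊤) ∧
    (∀ u : ℕ → D,
      (∀ ε > 0, ∃ N : ℕ, ∀ m ≥ N, ∀ n ≥ N, B (u m - u n) (u m - u n) + ‖u m - u n‖ ^ 2 < ε) →
      ∃ v : D, Tendsto (fun n : ℕ => B (u n - v) (u n - v) + ‖u n - v‖ ^ 2) atTop (𝓝 0))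

/-- Mosco convergence of the closed forms `E n` to the closed form `F`: the liminf inequality along
weakly convergent sequences, and the existence of a strongly convergent recovery sequence. -/
structure MoscoConverges (E : ℕ → H → ℝ≥0∞) (F : H → ℝ≥0∞) : Prop where
  isClosedForm : ∀ n, IsClosedForm (E n)
  isClosedForm_limit : IsClosedForm F
  le_liminf : ∀ (u : ℕ → H) (v : H),
    Tendsto (fun n => toWeakSpace ℝ H (u n)) atTop (𝓝 (toWeakSpace ℝ H v)) →
      F v ≤ liminf (fun n => E n (u n)) atTop
  exists_recovery : ∀ v : H, ∃ u : ℕ → H, Tendsto u atTop (𝓝 v) ∧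
    limsup (fun n => E n (u n)) atTop ≤ F v

end Mosco

end SierpinskiGasket

end

/-! For continuous `u` the numbers `a k = (5/3)^k * levelSum k u` are non-decreasing in `k`, with
supremum the local energy. With `r = 2^β/5`, the scaled energy is exactly the Abel mean `(1 - r) ∑
r^k a (k+1)` (`scaled_energyC_eq_abel`). Summation by parts (`tsum_abel`) rewrites it as a power
series in `r` whose coefficients are the non-negative increments of the sequence. Hence the scaled
energies increase with `β`, stay below the local energy, and converge to it as `r → 1`.

For an increasing sequence of closed forms with supremum the limit form, Mosco convergence is soft.
Constant sequences recover. For the liminf inequality fix `m`: weak lower semicontinuity of the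
`m`-th form and comparison with all later forms bound its value at the weak limit by the liminf, and
then `m` varies.

The analytic work is closedness and lower semicontinuity. Each energy is a supremum of continuous
quadratic forms on `C(K)`, so completeness of `C(K)` can be used once bounded energy together with a
small `L²` norm forces a small uniform norm. This coercivity (`isCoerciveAlong_of_levelSum_le`) is a
Morrey-type estimate: decay of the level sums controls the oscillation on cells by chaining, and
each cell has positive measure. Finiteness of the Hausdorff measure comes from the obvious
coverings; positivity on cells comes from the mass distribution principle for the image of the
Bernoulli measure (`map_code_le`). -/

noncomputable section

namespace SierpinskiGasket

/-! ### Closed forms as suprema of continuous quadratic forms -/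

section Abstract

variable {X : Type*} [NormedAddCommGroup X] [NormedSpace ℝ X]
variable {H : Type*} [NormedAddCommGroup H] [InnerProductSpace ℝ H]

/-- A non-decreasing sequence of continuous non-negative quadratic forms, given by symmetric
bilinear forms. -/
structure IsMonotoneFormSeq (Q : ℕ → X →ₗ[ℝ] X →ₗ[ℝ] ℝ) : Prop where
  symm : ∀ n u v, Q n u v = Q n v u
  nonneg : ∀ n u, 0 ≤ Q n u u
  mono : ∀ u, Monotone fun n => Q n u u
  cont : ∀ n, Continuous fun u => Q n u u

/-- On sublevel sets of `⨆ n, Q n`, smallness of `ι u` forces smallness of `u`. -/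
def IsCoerciveAlong (ι : X →L[ℝ] H) (Q : ℕ → X →ₗ[ℝ] X →ₗ[ℝ] ℝ) : Prop :=
  ∀ c ε : ℝ, 0 < ε → ∃ δ > 0, ∀ u, (∀ n, Q n u u ≤ c) → ‖ι u‖ ≤ δ → ‖u‖ ≤ ε

/-- The quadratic form `⨆ n, Q n`. -/
def supForm (Q : ℕ → X →ₗ[ℝ] X →ₗ[ℝ] ℝ) (u : X) : ℝ≥0∞ := ⨆ n, ENNReal.ofReal (Q n u u)

lemma supForm_le_ofReal {Q : ℕ → X →ₗ[ℝ] X →ₗ[ℝ] ℝ} {u : X} {c : ℝ} (hc : 0 ≤ c) :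
    supForm Q u ≤ ENNReal.ofReal c ↔ ∀ n, Q n u u ≤ c := by
  simp [supForm, ENNReal.ofReal_le_ofReal_iff hc]

namespace IsMonotoneFormSeq

variable {Q : ℕ → X →ₗ[ℝ] X →ₗ[ℝ] ℝ} (hQ : IsMonotoneFormSeq Q)
include hQ

lemma add_add (n : ℕ) (u v : X) :
    Q n (u + v) (u + v) = Q n u u + 2 * Q n u v + Q n v v := by
  simp only [map_add, LinearMap.add_apply, hQ.symm n v u]; ring

lemma parallelogram (n : ℕ) (u v : X) :
    Q n (u + v) (u + v) + Q n (u - v) (u - v) = 2 * Q n u u + 2 * Q n v v := by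
  simp only [map_add, map_sub, LinearMap.add_apply, LinearMap.sub_apply, hQ.symm n v u]; ring

lemma add_le (n : ℕ) (u v : X) : Q n (u + v) (u + v) ≤ 2 * Q n u u + 2 * Q n v v := by
  linarith [hQ.parallelogram n u v, hQ.nonneg n (u - v)]

lemma sub_le (n : ℕ) (u v : X) : Q n (u - v) (u - v) ≤ 2 * Q n u u + 2 * Q n v v := by
  linarith [hQ.parallelogram n u v, hQ.nonneg n (u + v)]

lemma convex_le (n : ℕ) (u v : X) {a b : ℝ} (ha : 0 ≤ a) (hb : 0 ≤ b) (hab : a + b = 1) :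
    Q n (a • u + b • v) (a • u + b • v) ≤ a * Q n u u + b * Q n v v := by
  have h1 : Q n (a • u + b • v) (a • u + b • v)
      = a * Q n u u + b * Q n v v - a * b * Q n (u - v) (u - v) := by
    obtain rfl : b = 1 - a := by linarith
    simp only [map_add, map_sub, map_smul, LinearMap.add_apply, LinearMap.sub_apply,
      LinearMap.smul_apply, smul_eq_mul, hQ.symm n v u]
    ring
  have := mul_nonneg (mul_nonneg ha hb) (hQ.nonneg n (u - v))
  linarith

/-- The domain `{u | sup_n Q n u u < ∞}`. -/
def domain : Submodule ℝ X where
  carrier := {u | ∃ c, ∀ n, Q n u u ≤ c}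
  zero_mem' := ⟨0, by simp⟩
  add_mem' := by
    rintro u v ⟨c, hc⟩ ⟨d, hd⟩
    exact ⟨2 * c + 2 * d, fun n => (hQ.add_le n u v).trans (by linarith [hc n, hd n])⟩
  smul_mem' := by
    rintro a u ⟨c, hc⟩
    refine ⟨a * (a * c), fun n => ?_⟩
    simp only [map_smul, LinearMap.smul_apply, smul_eq_mul]
    nlinarith [hc n, mul_self_nonneg a]

lemma exists_tendsto_diag {u : X} (hu : u ∈ hQ.domain) :
    ∃ l, Tendsto (fun n => Q n u u) atTop (𝓝 l) := by
  obtain ⟨c, hc⟩ := hu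
  exact ⟨_, tendsto_atTop_ciSup (hQ.mono u) ⟨c, by rintro _ ⟨n, rfl⟩; exact hc n⟩⟩

/-- Polarization reduces this to the bounded monotone diagonal sequences. -/
lemma exists_tendsto {u v : X} (hu : u ∈ hQ.domain) (hv : v ∈ hQ.domain) :
    ∃ l, Tendsto (fun n => Q n u v) atTop (𝓝 l) := by
  obtain ⟨a, ha⟩ := hQ.exists_tendsto_diag hu
  obtain ⟨b, hb⟩ := hQ.exists_tendsto_diag hv
  obtain ⟨c, hc⟩ := hQ.exists_tendsto_diag (hQ.domain.add_mem hu hv)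
  refine ⟨(c - a - b) / 2, (((hc.sub ha).sub hb).div_const 2).congr fun n => ?_⟩
  rw [hQ.add_add]; ring

lemma tendsto_limUnder (u v : hQ.domain) :
    Tendsto (fun n => Q n u v) atTop (𝓝 (limUnder atTop fun n => Q n (u : X) (v : X))) :=
  tendsto_nhds_limUnder (hQ.exists_tendsto u.2 v.2)

/-- The limiting bilinear form on the domain. -/
def limitForm : hQ.domain →ₗ[ℝ] hQ.domain →ₗ[ℝ] ℝ :=
  LinearMap.mk₂ ℝ (fun u v => limUnder atTop fun n => Q n (u : X) (v : X))
    (fun u v w => tendsto_nhds_unique (hQ.tendsto_limUnder (u + v) w)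
      (((hQ.tendsto_limUnder u w).add (hQ.tendsto_limUnder v w)).congr fun n => by simp))
    (fun a u v => tendsto_nhds_unique (hQ.tendsto_limUnder (a • u) v)
      (((hQ.tendsto_limUnder u v).const_mul a).congr fun n => by simp))
    (fun u v w => tendsto_nhds_unique (hQ.tendsto_limUnder u (v + w))
      (((hQ.tendsto_limUnder u v).add (hQ.tendsto_limUnder u w)).congr fun n => by simp))
    (fun a u v => tendsto_nhds_unique (hQ.tendsto_limUnder u (a • v))
      (((hQ.tendsto_limUnder u v).const_mul a).congr fun n => by simp))

lemma tendsto_limitForm (u v : hQ.domain) :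
    Tendsto (fun n => Q n u v) atTop (𝓝 (hQ.limitForm u v)) := hQ.tendsto_limUnder u v

lemma le_limitForm (u : hQ.domain) (n : ℕ) : Q n u u ≤ hQ.limitForm u u :=
  (hQ.mono (u : X)).ge_of_tendsto (hQ.tendsto_limitForm u u) n

lemma limitForm_le {u : hQ.domain} {c : ℝ} (h : ∀ n, Q n u u ≤ c) : hQ.limitForm u u ≤ c :=
  le_of_tendsto' (hQ.tendsto_limitForm u u) h

lemma supForm_eq (u : hQ.domain) : supForm Q u = ENNReal.ofReal (hQ.limitForm u u) := by
  refine tendsto_nhds_unique (tendsto_atTop_iSup fun m n h =>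
    ENNReal.ofReal_le_ofReal (hQ.mono (u : X) h)) ?_
  exact ENNReal.tendsto_ofReal (hQ.tendsto_limitForm u u)

lemma supForm_eq_top {u : X} (hu : u ∉ hQ.domain) : supForm Q u = ⊤ := by
  by_contra h
  refine hu ⟨(supForm Q u).toReal, ?_⟩
  rw [← supForm_le_ofReal ENNReal.toReal_nonneg, ENNReal.ofReal_toReal h]

variable [CompleteSpace X] {ι : X →L[ℝ] H}

omit hQ in
/-- A sequence of bounded energy whose image converges in `H` converges in `X`, provided that
differences have bounded energy. -/
lemma _root_.SierpinskiGasket.IsCoerciveAlong.exists_tendsto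
    (hc : IsCoerciveAlong ι Q) {x : ℕ → X} {c : ℝ} {N : ℕ}
    (hx : ∀ m ≥ N, ∀ n ≥ N, ∀ k, Q k (x m - x n) (x m - x n) ≤ c)
    (hι : CauchySeq fun n => ι (x n)) : ∃ y, Tendsto x atTop (𝓝 y) := by
  refine cauchySeq_tendsto_of_complete (Metric.cauchySeq_iff.2 fun ε hε => ?_)
  obtain ⟨δ, hδ, h⟩ := hc c (ε / 2) (by positivity)
  obtain ⟨M, hM⟩ := Metric.cauchySeq_iff.1 hι δ hδ
  refine ⟨max M N, fun m hm n hn => ?_⟩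
  have hm' := max_le_iff.1 hm
  have hn' := max_le_iff.1 hn
  have h1 := h (x m - x n) (hx m hm'.2 n hn'.2) (by
    rw [map_sub, ← dist_eq_norm]; exact (hM m hm'.1 n hn'.1).le)
  rw [dist_eq_norm]
  linarith

variable {E : H → ℝ≥0∞}

/-- A Cauchy sequence for the form norm is Cauchy in `H` and has differences of bounded energy, so
coercivity makes it converge already in `X`. There each `Q k` is continuous, and the Cauchy estimate
passes to the limit uniformly in `k`. -/
theorem isClosedForm (hc : IsCoerciveAlong ι Q) (hι : Function.Injective ι)
    (hE : ∀ x, E (ι x) = supForm Q x) (htop : ∀ u, u ∉ Set.range ι → E u = ⊤) :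
    IsClosedForm E := by
  let e := Submodule.equivMapOfInjective (ι : X →ₗ[ℝ] H) hι hQ.domain
  have he : ∀ u, ι ((e.symm u : hQ.domain) : X) = u := fun u => by
    have := Submodule.coe_equivMapOfInjective_apply (ι : X →ₗ[ℝ] H) hι hQ.domain (e.symm u)
    rw [show Submodule.equivMapOfInjective (ι : X →ₗ[ℝ] H) hι hQ.domain = e from rfl,
      e.apply_symm_apply] at this
    exact this.symm
  refine ⟨hQ.domain.map (ι : X →ₗ[ℝ] H),
    hQ.limitForm.compl₁₂ (e.symm : _ →ₗ[ℝ] hQ.domain) (e.symm : _ →ₗ[ℝ] hQ.domain),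
    ?_, ?_, ?_, ?_, ?_⟩
  · intro u v
    exact tendsto_nhds_unique (hQ.tendsto_limitForm _ _)
      ((hQ.tendsto_limitForm _ _).congr fun n => hQ.symm n _ _)
  · intro u
    exact (hQ.nonneg 0 _).trans (hQ.le_limitForm _ 0)
  · intro u
    have h : E u = supForm Q (e.symm u) := by rw [← hE, he]
    rw [h, hQ.supForm_eq]
    rfl
  · intro u hu
    by_cases h : u ∈ Set.range ι
    · obtain ⟨x, rfl⟩ := h
      rw [hE]
      exact hQ.supForm_eq_top fun hx => hu ⟨x, hx, rfl⟩
    · exact htop u h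
  · intro u hu
    set x : ℕ → hQ.domain := fun n => e.symm (u n)
    have hB : ∀ a b : hQ.domain.map (ι : X →ₗ[ℝ] H), hQ.limitForm.compl₁₂
        (e.symm : _ →ₗ[ℝ] hQ.domain) (e.symm : _ →ₗ[ℝ] hQ.domain) a b
        = hQ.limitForm (e.symm a) (e.symm b) := fun _ _ => rfl
    simp only [hB, map_sub e.symm] at hu ⊢
    have hnn : ∀ y : hQ.domain, 0 ≤ hQ.limitForm y y := fun y =>
      (hQ.nonneg 0 _).trans (hQ.le_limitForm _ 0)
    have hnorm : ∀ a b, ‖u a - u b‖ = ‖ι (x a) - ι (x b)‖ := fun a b => by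
      simp only [x, he]; rfl
    obtain ⟨N, hN⟩ := hu 1 one_pos
    have hCau : CauchySeq fun n => ι (x n) := by
      refine Metric.cauchySeq_iff.2 fun ε hε => ?_
      obtain ⟨M, hM⟩ := hu (ε ^ 2) (by positivity)
      refine ⟨M, fun m hm n hn => ?_⟩
      have h1 := hM m hm n hn
      have h2 := hnn (x m - x n)
      rw [dist_eq_norm, ← hnorm]
      exact lt_of_pow_lt_pow_left₀ 2 hε.le (by linarith)
    obtain ⟨y, hy⟩ := hc.exists_tendsto (x := fun n => (x n : X)) (c := 1) (N := N)
      (fun m hm n hn k => by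
        have h1 := hN m hm n hn
        have h2 := hQ.le_limitForm (x m - x n) k
        have h3 := sq_nonneg ‖u m - u n‖
        exact h2.trans (by linarith)) hCau
    -- `M` must not depend on `k`: with `n` and `k` fixed only the second index goes to infinity,
    -- and the supremum over `k` is taken afterwards.
    have key : ∀ ε > 0, ∃ M, ∀ n ≥ M, ∀ k, Q k (x n - y) (x n - y) ≤ ε := by
      intro ε hε
      obtain ⟨M, hM⟩ := hu ε hε
      refine ⟨M, fun n hn k => ?_⟩
      have ht : Tendsto (fun m => Q k (x n - x m) (x n - x m)) atTop
          (𝓝 (Q k (x n - y) (x n - y))) :=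
        ((hQ.cont k).tendsto _).comp (tendsto_const_nhds.sub hy)
      refine le_of_tendsto ht ((eventually_ge_atTop M).mono fun m hm => ?_)
      have h1 := hM n hn m hm
      have h2 := hQ.le_limitForm (x n - x m) k
      have h3 := sq_nonneg ‖u n - u m‖
      exact h2.trans (by linarith)
    have hyD : y ∈ hQ.domain := by
      obtain ⟨M, hM⟩ := key 1 one_pos
      have h1 : (x M : X) - y ∈ hQ.domain := ⟨1, hM M le_rfl⟩
      have h2 := hQ.domain.sub_mem (x M).2 h1
      rwa [sub_sub_cancel] at h2
    refine ⟨e ⟨y, hyD⟩, ?_⟩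
    simp only [e.symm_apply_apply]
    have h1 : Tendsto (fun n => hQ.limitForm (x n - ⟨y, hyD⟩) (x n - ⟨y, hyD⟩)) atTop (𝓝 0) := by
      refine Metric.tendsto_atTop.2 fun ε hε => ?_
      obtain ⟨M, hM⟩ := key (ε / 2) (by positivity)
      refine ⟨M, fun n hn => ?_⟩
      rw [Real.dist_0_eq_abs, abs_of_nonneg (hnn _)]
      have := hQ.limitForm_le (u := x n - ⟨y, hyD⟩) (hM n hn)
      linarith
    have h2 : Tendsto (fun n => ‖ι (x n) - ι y‖ ^ 2) atTop (𝓝 0) := by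
      have := (tendsto_iff_norm_sub_tendsto_zero.1 ((ι.continuous.tendsto y).comp hy)).pow 2
      simpa using this
    have h3 := h1.add h2
    rw [add_zero] at h3
    refine h3.congr fun n => ?_
    congr 2
    rw [show ι (x n) = (u n : H) from he _]
    rfl

/-- Differences of elements of the sublevel set have energy at most `4 * c`, so coercivity upgrades
convergence in `H` to convergence in `X`, where a supremum of continuous functions has closed
sublevel sets. -/
theorem isClosed_sublevel (hc : IsCoerciveAlong ι Q)
    (hE : ∀ x, E (ι x) = supForm Q x) (htop : ∀ u, u ∉ Set.range ι → E u = ⊤)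
    {c : ℝ} (hc0 : 0 ≤ c) : IsClosed {u | E u ≤ ENNReal.ofReal c} := by
  refine IsSeqClosed.isClosed fun u v hu huv => ?_
  have hr : ∀ n, ∃ x, ι x = u n := fun n => by
    by_contra h
    have h1 : E (u n) ≤ ENNReal.ofReal c := hu n
    rw [htop (u n) h] at h1
    exact ENNReal.ofReal_ne_top (top_le_iff.1 h1)
  choose x hx using hr
  have hxc : ∀ n k, Q k (x n) (x n) ≤ c := fun n => by
    rw [← supForm_le_ofReal hc0, ← hE, hx]; exact hu n
  obtain ⟨y, hy⟩ := hc.exists_tendsto (x := x) (c := 4 * c) (N := 0)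
    (fun m _ n _ k => (hQ.sub_le k _ _).trans (by linarith [hxc m k, hxc n k]))
    (by simp only [hx]; exact huv.cauchySeq)
  have hv : ι y = v := tendsto_nhds_unique ((ι.continuous.tendsto y).comp hy)
    (huv.congr fun n => (hx n).symm)
  change E v ≤ _
  rw [← hv, hE, supForm_le_ofReal hc0]
  exact fun k => le_of_tendsto' (((hQ.cont k).tendsto y).comp hy) fun n => hxc n k

omit [CompleteSpace X] in
theorem convex_sublevel (hE : ∀ x, E (ι x) = supForm Q x)
    (htop : ∀ u, u ∉ Set.range ι → E u = ⊤) {c : ℝ} (hc0 : 0 ≤ c) :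
    Convex ℝ {u | E u ≤ ENNReal.ofReal c} := by
  have hr : ∀ u, E u ≤ ENNReal.ofReal c → ∃ x, ι x = u := fun u hu => by
    by_contra h
    rw [htop u h] at hu
    exact ENNReal.ofReal_ne_top (top_le_iff.1 hu)
  intro u hu v hv a b ha hb hab
  obtain ⟨x, rfl⟩ := hr u hu
  obtain ⟨y, rfl⟩ := hr v hv
  simp only [Set.mem_ofPred_eq, hE, supForm_le_ofReal hc0] at hu hv
  rw [Set.mem_ofPred_eq, ← map_smul, ← map_smul, ← map_add, hE, supForm_le_ofReal hc0]
  intro n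
  refine (hQ.convex_le n x y ha hb hab).trans ?_
  nlinarith [hu n, hv n]

/-- Weak sequential lower semicontinuity. -/
theorem le_liminf_of_tendsto_weak (hc : IsCoerciveAlong ι Q)
    (hE : ∀ x, E (ι x) = supForm Q x) (htop : ∀ u, u ∉ Set.range ι → E u = ⊤)
    {u : ℕ → H} {v : H}
    (huv : Tendsto (fun n => toWeakSpace ℝ H (u n)) atTop (𝓝 (toWeakSpace ℝ H v))) :
    E v ≤ liminf (fun n => E (u n)) atTop := by
  by_contra! h
  obtain ⟨c, hlc, hcv⟩ := ENNReal.lt_iff_exists_nnreal_btwn.1 h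
  have hfreq := frequently_lt_of_liminf_lt (by isBoundedDefault) hlc
  rw [← ENNReal.ofReal_coe_nnreal] at hcv hfreq
  have hS := hQ.convex_sublevel hE htop c.2
  -- Mazur: a norm-closed convex set is weakly closed.
  have hcl : IsClosed (toWeakSpace ℝ H '' {u | E u ≤ ENNReal.ofReal c}) := by
    have h1 := hS.toWeakSpace_closure ℝ
    rw [(hQ.isClosed_sublevel hc hE htop c.2).closure_eq] at h1
    exact closure_eq_iff_isClosed.1 h1.symm
  obtain ⟨w, hw, hwv⟩ := hcl.mem_of_frequently_of_tendsto
    (hfreq.mono fun n hn => ⟨u n, hn.le, rfl⟩) huv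
  rw [(toWeakSpace ℝ H).injective hwv] at hw
  exact (not_le.2 hcv) hw

end IsMonotoneFormSeq

end Abstract

/-! ### Cells of the gasket -/

lemma norm_le_of_mem_gasket {x : Plane} (hx : x ∈ gasket) : ‖x‖ ≤ 1 := by
  have h : gasket ⊆ Metric.closedBall (0 : Plane) 1 := by
    refine closure_minimal (Set.iUnion_subset fun n x hx => ?_) Metric.isClosed_closedBall
    simpa using norm_le_of_mem_vertexSet n x hx
  simpa using h hx

lemma dist_le_two (x y : SG) : dist x y ≤ 2 := by
  have h1 := norm_le_of_mem_gasket x.2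
  have h2 := norm_le_of_mem_gasket y.2
  have h3 := norm_sub_le x.1 y.1
  rw [Subtype.dist_eq, dist_eq_norm]
  linarith

lemma corner_zero : corner 0 = 0 := by
  ext k; fin_cases k <;> simp [corner]

lemma dist_sgCorner_zero (x : SG) : dist x (sgCorner 0) ≤ 1 := by
  have h : dist x (sgCorner 0) = dist x.1 (corner 0) := rfl
  rw [h, corner_zero, dist_zero_right]
  exact norm_le_of_mem_gasket x.2

lemma dist_wordMap (n : ℕ) (w : Fin n → Fin 3) (x y : SG) :
    dist (wordMap n w x) (wordMap n w y) = (1 / 2) ^ n * dist x y := by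
  induction n with
  | zero => simp [wordMap]
  | succ n ih =>
    have h := dist_contr (w 0) (wordMap n (Fin.tail w) x).1 (wordMap n (Fin.tail w) y).1
    rw [← Subtype.dist_eq, ih] at h
    rw [Subtype.dist_eq]
    refine h.trans ?_
    ring

lemma continuous_wordMap (n : ℕ) (w : Fin n → Fin 3) : Continuous (wordMap n w) := by
  refine (LipschitzWith.of_dist_le_mul (K := (1 / 2) ^ n) fun x y => ?_).continuous
  rw [dist_wordMap]
  simp

lemma exists_wordMap_eq (n : ℕ) (x : SG) : ∃ w y, wordMap n w y = x := by
  induction n generalizing x with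
  | zero => exact ⟨Fin.elim0, x, rfl⟩
  | succ n ih =>
    obtain ⟨i, y, hy, hyx⟩ := Set.mem_iUnion.1 (gasket_eq_iUnion.subset x.2)
    obtain ⟨w, z, hz⟩ := ih ⟨y, hy⟩
    refine ⟨Fin.cons i w, z, ?_⟩
    rw [wordMap, Fin.cons_zero, Fin.tail_cons, Function.comp_apply, hz]
    exact Subtype.ext hyx

lemma isClosed_range_wordMap (n : ℕ) (w : Fin n → Fin 3) : IsClosed (Set.range (wordMap n w)) :=
  (isCompact_range (continuous_wordMap n w)).isClosed

lemma ediam_range_wordMap_le (n : ℕ) (w : Fin n → Fin 3) :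
    Metric.ediam (Set.range (wordMap n w)) ≤ ENNReal.ofReal (2 * (1 / 2) ^ n) := by
  refine Metric.ediam_le ?_
  rintro _ ⟨x, rfl⟩ _ ⟨y, rfl⟩
  rw [edist_dist, dist_wordMap]
  refine ENNReal.ofReal_le_ofReal ?_
  rw [mul_comm]
  gcongr
  exact dist_le_two x y

/-! ### Finiteness of the Hausdorff measure -/

lemma two_rpow_hausdorffDim : (2 : ℝ) ^ hausdorffDim = 3 := by
  rw [hausdorffDim, Real.rpow_def_of_pos (by norm_num), mul_div_cancel₀ _
    (Real.log_pos (by norm_num)).ne', Real.exp_log (by norm_num)]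

lemma two_rpow_walkDim : (2 : ℝ) ^ walkDim = 5 := by
  rw [walkDim, Real.rpow_def_of_pos (by norm_num), mul_div_cancel₀ _
    (Real.log_pos (by norm_num)).ne', Real.exp_log (by norm_num)]

lemma hausdorffDim_pos : 0 < hausdorffDim :=
  div_pos (Real.log_pos (by norm_num)) (Real.log_pos (by norm_num))

lemma half_pow_rpow_hausdorffDim (n : ℕ) : (((1 : ℝ) / 2) ^ n) ^ hausdorffDim = (1 / 3) ^ n := by
  rw [← Real.rpow_natCast, ← Real.rpow_mul (by norm_num), mul_comm, Real.rpow_mul (by norm_num),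
    Real.div_rpow (by norm_num) (by norm_num), two_rpow_hausdorffDim, Real.one_rpow,
    Real.rpow_natCast]

/-- The `3^n` cells of level `n` have diameter at most `2 * 2⁻ⁿ`, and the `α`-th power of this bound
is `3 * 3⁻ⁿ`, so every covering sum is at most `3`. -/
lemma hausdorffMeasure_univ_lt_top :
    Measure.hausdorffMeasure hausdorffDim (Set.univ : Set SG) < ⊤ := by
  have h := Measure.hausdorffMeasure_le_liminf_sum (X := SG) (ι := fun n : ℕ => Fin n → Fin 3)
    (l := atTop) hausdorffDim Set.univ (fun n => ENNReal.ofReal (2 * (1 / 2) ^ n))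
    (by
      have h1 : Tendsto (fun n : ℕ => 2 * (1 / 2 : ℝ) ^ n) atTop (𝓝 (2 * 0)) :=
        (tendsto_pow_atTop_nhds_zero_of_lt_one (by norm_num) (by norm_num)).const_mul 2
      simpa using ENNReal.tendsto_ofReal h1)
    (fun n w => Set.range (wordMap n w))
    (Eventually.of_forall fun n w => ediam_range_wordMap_le n w)
    (Eventually.of_forall fun n x _ => by
      obtain ⟨w, y, rfl⟩ := exists_wordMap_eq n x
      exact Set.mem_iUnion.2 ⟨w, y, rfl⟩)
  refine h.trans_lt (lt_of_le_of_lt (b := ENNReal.ofReal 3) ?_ ENNReal.ofReal_lt_top)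
  refine liminf_le_of_le (by isBoundedDefault) fun b hb => ?_
  obtain ⟨n, hn⟩ := hb.exists
  refine hn.trans ?_
  calc ∑ w : Fin n → Fin 3, Metric.ediam (Set.range (wordMap n w)) ^ hausdorffDim
      ≤ ∑ w : Fin n → Fin 3, ENNReal.ofReal (3 * (1 / 3) ^ n) := by
        refine Finset.sum_le_sum fun w _ => ?_
        rw [← half_pow_rpow_hausdorffDim, ← two_rpow_hausdorffDim,
          ← Real.mul_rpow (by norm_num) (by positivity),
          ← ENNReal.ofReal_rpow_of_nonneg (by positivity) hausdorffDim_pos.le]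
        exact ENNReal.rpow_le_rpow (ediam_range_wordMap_le n w) hausdorffDim_pos.le
    _ = ENNReal.ofReal 3 := by
        rw [Finset.sum_const, nsmul_eq_mul, Finset.card_univ, Fintype.card_fun, Fintype.card_fin,
          Fintype.card_fin, ← ENNReal.ofReal_natCast, ← ENNReal.ofReal_mul (by positivity)]
        congr 1
        push_cast
        rw [mul_comm (3 : ℝ), ← mul_assoc, ← mul_pow]
        norm_num

/-! ### The coding map -/

/-- The point of the plane with address `x`. -/
def codePlane (x : ℕ → Fin 3) : Plane := ∑' i : ℕ, ((1 / 2 : ℝ) ^ (i + 1)) • corner (x i)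

lemma norm_code_term_le (x : ℕ → Fin 3) (i : ℕ) :
    ‖((1 / 2 : ℝ) ^ (i + 1)) • corner (x i)‖ ≤ (1 / 2) ^ (i + 1) := by
  rw [norm_smul, Real.norm_of_nonneg (by positivity)]
  exact mul_le_of_le_one_right (by positivity) (norm_corner_le _)

lemma summable_half_pow_succ : Summable fun i : ℕ => (1 / 2 : ℝ) ^ (i + 1) :=
  (summable_nat_add_iff 1).2 (summable_geometric_of_lt_one (by norm_num) (by norm_num))

lemma summable_code (x : ℕ → Fin 3) :
    Summable fun i : ℕ => ((1 / 2 : ℝ) ^ (i + 1)) • corner (x i) :=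
  Summable.of_norm_bounded summable_half_pow_succ (norm_code_term_le x)

lemma continuous_codePlane : Continuous codePlane := by
  refine continuous_tsum (fun i => ?_) summable_half_pow_succ (fun i x => norm_code_term_le x i)
  have h : Continuous fun x : ℕ → Fin 3 => corner (x i) :=
    (continuous_of_discreteTopology (f := corner)).comp (continuous_apply (A := fun _ => Fin 3) i)
  exact h.const_smul ((1 / 2 : ℝ) ^ (i + 1))

lemma codePlane_eq (x : ℕ → Fin 3) : codePlane x = contr (x 0) (codePlane fun i => x (i + 1)) := by
  rw [codePlane, (summable_code x).tsum_eq_zero_add, contr, codePlane, smul_add, add_comm,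
    ← (summable_code fun i => x (i + 1)).tsum_const_smul]
  simp only [smul_smul, zero_add, pow_one]
  congr 2
  funext i
  rw [← pow_succ']

/-- The range is compact and self-similar, so the uniqueness of the gasket identifies it. -/
lemma range_codePlane : Set.range codePlane = gasket := by
  refine eq_gasket (Set.range_nonempty _) (isCompact_range continuous_codePlane) ?_
  ext p
  simp only [Set.mem_range, Set.mem_iUnion, Set.mem_image, exists_exists_eq_and]
  constructor
  · rintro ⟨x, rfl⟩
    exact ⟨x 0, _, (codePlane_eq x).symm⟩
  · rintro ⟨i, x, rfl⟩
    let y : ℕ → Fin 3 := fun n => if n = 0 then i else x (n - 1)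
    have hy : (fun n => y (n + 1)) = x := by funext n; simp [y]
    exact ⟨y, by rw [codePlane_eq y, hy]; rfl⟩

/-- The point of the gasket with address `x`. -/
def code (x : ℕ → Fin 3) : SG := ⟨codePlane x, range_codePlane ▸ Set.mem_range_self x⟩

lemma continuous_code : Continuous code := continuous_codePlane.subtype_mk _

lemma code_eq_wordMap (n : ℕ) (x : ℕ → Fin 3) :
    code x = wordMap n (fun i => x i) (code fun i => x (i + n)) := by
  induction n generalizing x with
  | zero => rfl
  | succ n ih =>
    have h : code x = sgContr (x 0) (code fun i => x (i + 1)) := Subtype.ext (codePlane_eq x)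
    rw [h, ih]
    simp only [wordMap, Function.comp_apply, add_assoc]
    rfl

/-! ### Lattice coordinates of cells -/

/-- The number whose `n` binary digits mark the letters `e` of `w`. -/
def letterNum (e : Fin 3) : (n : ℕ) → (Fin n → Fin 3) → ℕ
  | 0, _ => 0
  | n + 1, w => (if w 0 = e then 2 ^ n else 0) + letterNum e n (Fin.tail w)

lemma letterNum_lt (e : Fin 3) (n : ℕ) (w : Fin n → Fin 3) : letterNum e n w < 2 ^ n := by
  induction n with
  | zero => simp [letterNum]
  | succ n ih =>
    have := ih (Fin.tail w)
    rw [letterNum, pow_succ]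
    split_ifs <;> omega

/-- The leading binary digit can be read off because the tails contribute less than `2 ^ n`; whether
a letter is `1` and whether it is `2` determine it. -/
lemma letterNum_injective (n : ℕ) (v w : Fin n → Fin 3)
    (h1 : letterNum 1 n v = letterNum 1 n w) (h2 : letterNum 2 n v = letterNum 2 n w) : v = w := by
  induction n with
  | zero => exact Subsingleton.elim _ _
  | succ n ih =>
    have a1 := letterNum_lt 1 n (Fin.tail v)
    have a2 := letterNum_lt 1 n (Fin.tail w)
    have a3 := letterNum_lt 2 n (Fin.tail v)
    have a4 := letterNum_lt 2 n (Fin.tail w)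
    rw [letterNum, letterNum] at h1 h2
    have h1' : (v 0 = 1 ↔ w 0 = 1) ∧ letterNum 1 n (Fin.tail v) = letterNum 1 n (Fin.tail w) := by
      split_ifs at h1 with p q q <;> simp only [p, q, true_and] <;> omega
    have h2' : (v 0 = 2 ↔ w 0 = 2) ∧ letterNum 2 n (Fin.tail v) = letterNum 2 n (Fin.tail w) := by
      split_ifs at h2 with p q q <;> simp only [p, q, true_and] <;> omega
    have h0 : v 0 = w 0 := by
      have e1 := h1'.1
      have e2 := h2'.1
      generalize v 0 = a at e1 e2
      generalize w 0 = b at e1 e2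
      revert a b
      decide
    rw [← Fin.cons_self_tail v, ← Fin.cons_self_tail w, h0, ih _ _ h1'.2 h2'.2]

lemma wordMap_sgCorner_zero (n : ℕ) (w : Fin n → Fin 3) :
    (wordMap n w (sgCorner 0)).1 = ((1 / 2 : ℝ) ^ n) •
      ((letterNum 1 n w : ℝ) • corner 1 + (letterNum 2 n w : ℝ) • corner 2) := by
  induction n with
  | zero => simp [wordMap, letterNum, sgCorner, corner_zero]
  | succ n ih =>
    have h : (wordMap (n + 1) w (sgCorner 0)).1
      = contr (w 0) (wordMap n (Fin.tail w) (sgCorner 0)).1 := rfl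
    have hp : (1 / 2 : ℝ) ^ n * 2 ^ n = 1 := by rw [← mul_pow]; norm_num
    have key : corner (w 0) = ((1 / 2 : ℝ) ^ n) • (((if w 0 = 1 then 2 ^ n else 0 : ℕ) : ℝ) • corner 1
        + ((if w 0 = 2 then 2 ^ n else 0 : ℕ) : ℝ) • corner 2) := by
      generalize w 0 = a
      fin_cases a <;> simp [corner_zero, smul_smul]
    rw [h, ih, contr]
    nth_rewrite 1 [key]
    simp only [letterNum, Nat.cast_add, pow_succ]
    module

/-- The squared norm is `a² + ab + b²`. Completing the square in either variable gives `a², b² ≤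
12`; the box is not optimal in `a`. -/
lemma abs_le_of_norm_le (a b : ℤ) (h : ‖(a : ℝ) • corner 1 + (b : ℝ) • corner 2‖ ≤ 3) :
    a ∈ Finset.Icc (-5 : ℤ) 5 ∧ b ∈ Finset.Icc (-3 : ℤ) 3 := by
  have h2 : ‖(a : ℝ) • corner 1 + (b : ℝ) • corner 2‖ ^ 2 = (a + b * (1 / 2)) ^ 2 + b ^ 2 * (3 / 4) := by
    rw [EuclideanSpace.norm_sq_eq]
    simp [corner, mul_pow, div_pow]
    norm_num
  have h3 : ((a : ℝ) + b * (1 / 2)) ^ 2 + b ^ 2 * (3 / 4) ≤ 9 := by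
    rw [← h2]; nlinarith [norm_nonneg ((a : ℝ) • corner 1 + (b : ℝ) • corner 2)]
  have hb : (b : ℝ) ^ 2 ≤ 12 := by nlinarith [sq_nonneg ((a : ℝ) + b * (1 / 2))]
  have ha : (a : ℝ) ^ 2 ≤ 12 := by nlinarith [sq_nonneg ((b : ℝ) + a * (1 / 2))]
  have hb' : b ^ 2 ≤ 12 := by exact_mod_cast hb
  have ha' : a ^ 2 ≤ 12 := by exact_mod_cast ha
  simp only [Finset.mem_Icc]
  refine ⟨⟨?_, ?_⟩, ?_, ?_⟩ <;> nlinarith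

/-! ### Positivity of the Hausdorff measure -/

/-- The Bernoulli measure on addresses. -/
def addressMeasure : Measure (ℕ → Fin 3) :=
  Measure.infinitePi fun _ => (PMF.uniformOfFintype (Fin 3)).toMeasure

lemma addressMeasure_cylinder (n : ℕ) (w : Fin n → Fin 3) :
    addressMeasure {x | (fun i : Fin n => x i) = w} = ENNReal.ofReal ((1 / 3) ^ n) := by
  let t : ℕ → Set (Fin 3) := fun i => if h : i < n then {w ⟨i, h⟩} else Set.univ
  have h : {x : ℕ → Fin 3 | (fun i : Fin n => x i) = w} = Set.pi (Finset.range n) t := by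
    ext x
    simp only [Set.mem_ofPred_eq, Set.mem_pi, Finset.coe_range, Set.mem_Iio, funext_iff]
    constructor
    · intro hx i hi
      simp [t, hi, ← hx]
    · intro hx i
      simpa [t, i.2] using hx i i.2
  rw [h, addressMeasure, Measure.infinitePi_pi _ fun i _ => by measurability]
  have hi : ∀ i ∈ Finset.range n,
      (PMF.uniformOfFintype (Fin 3)).toMeasure (t i) = ENNReal.ofReal (1 / 3) := by
    intro i hi
    have : t i = {w ⟨i, Finset.mem_range.1 hi⟩} := by simp [t, Finset.mem_range.1 hi]
    rw [this, PMF.toMeasure_apply_singleton _ _ (measurableSet_singleton _),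
      PMF.uniformOfFintype_apply, Fintype.card_fin, one_div,
      ENNReal.ofReal_inv_of_pos (by norm_num)]
    simp
  rw [Finset.prod_congr rfl hi, Finset.prod_const, Finset.card_range,
    ENNReal.ofReal_pow (by norm_num)]

open Classical in
/-- A set of diameter at most `2⁻ⁿ` meets at most `77` cells of level `n`. -/
lemma card_words_le (n : ℕ) {s : Set SG} (hs : Metric.ediam s ≤ ENNReal.ofReal ((1 / 2) ^ n)) :
    (Finset.univ.filter fun w : Fin n → Fin 3 =>
      ∃ x : ℕ → Fin 3, code x ∈ s ∧ (fun i : Fin n => x i) = w).card ≤ 77 := by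
  set T := Finset.univ.filter fun w : Fin n → Fin 3 =>
      ∃ x : ℕ → Fin 3, code x ∈ s ∧ (fun i : Fin n => x i) = w
  rcases T.eq_empty_or_nonempty with hT | ⟨v, hv⟩
  · simp [hT]
  -- The factor `3` counts three legs: from one base corner to a point of `s`, across `s`, and to
  -- the other base corner.
  have hdist : ∀ w ∈ T, dist (wordMap n w (sgCorner 0)) (wordMap n v (sgCorner 0))
      ≤ 3 * (1 / 2) ^ n := by
    intro w hw
    obtain ⟨x, hx, rfl⟩ := (Finset.mem_filter.1 hw).2
    obtain ⟨y, hy, rfl⟩ := (Finset.mem_filter.1 hv).2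
    have h1 : ∀ z : ℕ → Fin 3,
        dist (code z) (wordMap n (fun i => z i) (sgCorner 0)) ≤ (1 / 2) ^ n := fun z => by
      rw [code_eq_wordMap n, dist_wordMap]
      exact mul_le_of_le_one_right (by positivity) (dist_sgCorner_zero _)
    have h2 : dist (code x) (code y) ≤ (1 / 2) ^ n := by
      rw [← ENNReal.ofReal_le_ofReal_iff (by positivity), ← edist_dist]
      exact (Metric.edist_le_ediam_of_mem hx hy).trans hs
    have h3 := dist_triangle4 (wordMap n (fun i => x i) (sgCorner 0)) (code x) (code y)
      (wordMap n (fun i => y i) (sgCorner 0))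
    have h4 := h1 x
    rw [dist_comm] at h4
    linarith [h1 y]
  have hcard : ((Finset.Icc (-5 : ℤ) 5) ×ˢ (Finset.Icc (-3 : ℤ) 3)).card = 77 := by simp
  rw [← hcard]
  -- Base corners of cells are lattice points at scale `2⁻ⁿ`, distinct for distinct words, so
  -- counting words becomes counting lattice points near that of `v`.
  refine Finset.card_le_card_of_injOn (fun w => ((letterNum 1 n w : ℤ) - letterNum 1 n v,
    (letterNum 2 n w : ℤ) - letterNum 2 n v)) (fun w hw => ?_) (fun w _ w' _ h => ?_)
  · rw [Finset.mem_coe, Finset.mem_product]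
    refine abs_le_of_norm_le _ _ ?_
    have h1 := hdist w hw
    rw [Subtype.dist_eq, dist_eq_norm, wordMap_sgCorner_zero, wordMap_sgCorner_zero, ← smul_sub,
      norm_smul, Real.norm_of_nonneg (by positivity), mul_comm] at h1
    have h2 := le_of_mul_le_mul_right h1 (by positivity)
    refine le_of_eq_of_le (congrArg _ ?_) h2
    push_cast
    module
  · simp only [Prod.mk.injEq] at h
    exact letterNum_injective n w w' (by omega) (by omega)

lemma addressMeasure_preimage_le (n : ℕ) {s : Set SG}
    (hs : Metric.ediam s ≤ ENNReal.ofReal ((1 / 2) ^ n)) :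
    addressMeasure (code ⁻¹' s) ≤ ENNReal.ofReal (77 * (1 / 3) ^ n) := by
  classical
  set T := Finset.univ.filter fun w : Fin n → Fin 3 =>
      ∃ x : ℕ → Fin 3, code x ∈ s ∧ (fun i : Fin n => x i) = w with hT
  have hsub : code ⁻¹' s ⊆ ⋃ w ∈ T, {x | (fun i : Fin n => x i) = w} := fun x hx =>
    Set.mem_iUnion₂.2 ⟨fun i => x i, Finset.mem_filter.2 ⟨Finset.mem_univ _, x, hx, rfl⟩, rfl⟩
  refine (measure_mono hsub).trans ((measure_biUnion_finset_le _ _).trans ?_)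
  simp only [addressMeasure_cylinder, Finset.sum_const, nsmul_eq_mul]
  rw [ENNReal.ofReal_mul (by norm_num)]
  gcongr
  have := card_words_le n hs
  rw [← hT] at this
  rw [ENNReal.ofReal_ofNat]
  exact_mod_cast this

/-- For positive diameter `d` choose `n` with `2^{-(n+1)} < d ≤ 2⁻ⁿ`. Then `3⁻ⁿ = 3 * 3^{-(n+1)}` is
at most `3 * d^α`, whence `231 = 77 * 3`. For diameter `0` every `n` is allowed and the measure
vanishes. -/
lemma addressMeasure_preimage_le_rpow {s : Set SG} (hs : Metric.ediam s ≤ 1) :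
    addressMeasure (code ⁻¹' s) ≤ ENNReal.ofReal 231 * Metric.ediam s ^ hausdorffDim := by
  obtain ⟨d, hd⟩ : ∃ d : NNReal, Metric.ediam s = d :=
    ⟨_, (ENNReal.coe_toNNReal (ne_top_of_le_ne_top ENNReal.one_ne_top hs)).symm⟩
  rw [hd] at hs ⊢
  rw [← ENNReal.ofReal_coe_nnreal]
  rcases eq_or_lt_of_le d.coe_nonneg with h0 | h0
  · have h1 : ∀ n : ℕ, addressMeasure (code ⁻¹' s) ≤ ENNReal.ofReal (77 * (1 / 3) ^ n) :=
      fun n => addressMeasure_preimage_le n (by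
        rw [hd, ← ENNReal.ofReal_coe_nnreal]
        exact ENNReal.ofReal_le_ofReal (h0.symm.trans_le (by positivity)))
    have h2 : Tendsto (fun n : ℕ => ENNReal.ofReal (77 * (1 / 3) ^ n)) atTop (𝓝 0) := by
      have := (tendsto_pow_atTop_nhds_zero_of_lt_one (r := (1 / 3 : ℝ)) (by norm_num)
        (by norm_num)).const_mul 77
      simpa using ENNReal.tendsto_ofReal this
    exact (ge_of_tendsto' h2 h1).trans zero_le
  · obtain ⟨n, hn1, hn2⟩ := exists_nat_pow_near_of_lt_one (y := (1 / 2 : ℝ)) h0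
      (by exact_mod_cast hs) (by norm_num) (by norm_num)
    refine (addressMeasure_preimage_le n ?_).trans ?_
    · rw [hd, ← ENNReal.ofReal_coe_nnreal]
      exact ENNReal.ofReal_le_ofReal hn2
    · rw [ENNReal.ofReal_rpow_of_nonneg d.coe_nonneg hausdorffDim_pos.le,
        ← ENNReal.ofReal_mul (by norm_num)]
      refine ENNReal.ofReal_le_ofReal ?_
      have := Real.rpow_le_rpow (by positivity) hn1.le hausdorffDim_pos.le
      rw [half_pow_rpow_hausdorffDim, pow_succ] at this
      linarith

/-- Mass distribution principle. Replacing `s` by its closure gives measurability without changing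
the diameter. -/
lemma map_code_le :
    (ENNReal.ofReal 231)⁻¹ • addressMeasure.map code ≤ Measure.hausdorffMeasure hausdorffDim := by
  refine Measure.le_hausdorffMeasure _ _ 1 one_pos fun s hs => ?_
  refine (measure_mono subset_closure).trans ?_
  rw [Measure.smul_apply, smul_eq_mul,
    Measure.map_apply continuous_code.measurable isClosed_closure.measurableSet,
    ENNReal.inv_mul_le_iff (by simp) (by simp), ← Metric.ediam_closure s]
  exact addressMeasure_preimage_le_rpow (by rwa [Metric.ediam_closure])

lemma hausdorffMeasure_cell_pos (n : ℕ) (w : Fin n → Fin 3) :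
    0 < Measure.hausdorffMeasure hausdorffDim (Set.range (wordMap n w)) := by
  refine lt_of_lt_of_le ?_ (map_code_le _)
  rw [Measure.smul_apply, smul_eq_mul,
    Measure.map_apply continuous_code.measurable (isClosed_range_wordMap n w).measurableSet]
  refine ENNReal.mul_pos (by simp) ?_
  refine (lt_of_lt_of_le ?_ (measure_mono (s := {x | (fun i : Fin n => x i) = w}) ?_)).ne'
  · rw [addressMeasure_cylinder]
    exact ENNReal.ofReal_pos.2 (by positivity)
  · rintro x rfl
    exact ⟨_, (code_eq_wordMap n x).symm⟩

instance : IsProbabilityMeasure sgMeasure := by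
  refine ⟨?_⟩
  have h := (hausdorffMeasure_cell_pos 0 Fin.elim0).trans_le (measure_mono (Set.subset_univ _))
  rw [sgMeasure, Measure.smul_apply, smul_eq_mul]
  exact ENNReal.inv_mul_cancel h.ne' hausdorffMeasure_univ_lt_top.ne

lemma sgMeasure_cell_pos (n : ℕ) (w : Fin n → Fin 3) :
    0 < sgMeasure (Set.range (wordMap n w)) := by
  rw [sgMeasure, Measure.smul_apply, smul_eq_mul]
  exact ENNReal.mul_pos (ENNReal.inv_ne_zero.2 hausdorffMeasure_univ_lt_top.ne)
    (hausdorffMeasure_cell_pos n w).ne'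

/-- Every non-empty open set contains a small cell. This makes continuous versions unique. -/
instance : sgMeasure.IsOpenPosMeasure := by
  refine ⟨fun U hU ⟨x, hx⟩ => ?_⟩
  obtain ⟨ε, hε, hball⟩ := Metric.isOpen_iff.1 hU x hx
  obtain ⟨n, hn⟩ := exists_pow_lt_of_lt_one (half_pos hε) (by norm_num : (1 / 2 : ℝ) < 1)
  obtain ⟨w, y, rfl⟩ := exists_wordMap_eq n x
  refine ((sgMeasure_cell_pos n w).trans_le (measure_mono ?_)).ne'
  rintro _ ⟨z, rfl⟩
  refine hball ?_
  rw [Metric.mem_ball, dist_wordMap]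
  have h1 : (0 : ℝ) < (1 / 2) ^ n := by positivity
  nlinarith [dist_le_two z y]

/-! ### Oscillation on cells -/

lemma sq_sub_le_levelSum (n : ℕ) (u : C(SG, ℝ)) (w : Fin n → Fin 3) (i j : Fin 3) :
    (u (wordMap n w (sgCorner i)) - u (wordMap n w (sgCorner j))) ^ 2 ≤ levelSum n u := by
  rw [levelSum_eq]
  refine le_trans ?_ (Finset.single_le_sum (f := fun w => ∑ i : Fin 3, ∑ j : Fin 3,
      (u (wordMap n w (sgCorner i)) - u (wordMap n w (sgCorner j))) ^ 2)
    (fun w _ => by positivity) (Finset.mem_univ w))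
  refine le_trans ?_ (Finset.single_le_sum (f := fun i => ∑ j : Fin 3,
      (u (wordMap n w (sgCorner i)) - u (wordMap n w (sgCorner j))) ^ 2)
    (fun i _ => by positivity) (Finset.mem_univ i))
  exact Finset.single_le_sum (f := fun j =>
      (u (wordMap n w (sgCorner i)) - u (wordMap n w (sgCorner j))) ^ 2)
    (fun j _ => by positivity) (Finset.mem_univ j)

lemma levelSum_nonneg (n : ℕ) (u : C(SG, ℝ)) : 0 ≤ levelSum n u := by
  rw [levelSum_eq]; positivity

lemma dense_vertices : Dense {x : SG | x.1 ∈ ⋃ n, vertexSet n} := by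
  have himg : Subtype.val '' {x : SG | x.1 ∈ ⋃ n, vertexSet n} = ⋃ n, vertexSet n := by
    ext x
    constructor
    · rintro ⟨y, hy, rfl⟩; exact hy
    · exact fun hx => ⟨⟨x, subset_closure hx⟩, hx, rfl⟩
  intro x
  rw [Topology.IsEmbedding.subtypeVal.closure_eq_preimage_closure_image, himg]
  exact x.2

/-- Geometric decay of the level sums controls the oscillation on cells. -/
lemma abs_sub_corner_le {u : C(SG, ℝ)} {M θ : ℝ} (hM : 0 ≤ M) (hθ0 : 0 ≤ θ) (hθ1 : θ < 1)
    (h : ∀ n ≥ 1, levelSum n u ≤ M * θ ^ n) {n : ℕ} (hn : 1 ≤ n) (w : Fin n → Fin 3) (i : Fin 3)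
    (x : SG) :
    |u (wordMap n w x) - u (wordMap n w (sgCorner i))| ≤ √M * √θ ^ n / (1 - √θ) := by
  have hρ : √θ < 1 := by rw [Real.sqrt_lt' one_pos]; simpa using hθ1
  have hρ0 := Real.sqrt_nonneg θ
  have hstep : ∀ {n : ℕ}, 1 ≤ n → ∀ (w : Fin n → Fin 3) (i j : Fin 3),
      |u (wordMap n w (sgCorner j)) - u (wordMap n w (sgCorner i))| ≤ √M * √θ ^ n := by
    intro n hn w i j
    refine abs_le_of_sq_le_sq ((sq_sub_le_levelSum n u w j i).trans ((h n hn).trans_eq ?_))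
      (by positivity)
    rw [mul_pow, Real.sq_sqrt hM, ← pow_mul, mul_comm n 2, pow_mul, Real.sq_sqrt hθ0]
  -- Chaining, with `n` and `w` general in the induction: a vertex of depth `k + 1` in a cell has
  -- depth `k` in the `j`-th subcell, whose `j`-th corner is also the `j`-th corner of the big cell.
  -- With `ρ = √θ` the bound reproduces itself since `ρ^{n+1}/(1-ρ) + ρ^n = ρ^n/(1-ρ)`.
  have hvert : ∀ (k : ℕ) (y : SG), y.1 ∈ vertexSet k → ∀ {n : ℕ}, 1 ≤ n →
      ∀ (w : Fin n → Fin 3) (i : Fin 3),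
      |u (wordMap n w y) - u (wordMap n w (sgCorner i))| ≤ √M * √θ ^ n / (1 - √θ) := by
    intro k
    induction k with
    | zero =>
      rintro ⟨_, hy⟩ ⟨j, rfl⟩ n hn w i
      refine (hstep hn w i j).trans ?_
      rw [le_div_iff₀ (by linarith)]
      exact mul_le_of_le_one_right (by positivity) (by linarith)
    | succ k ih =>
      intro y hy n hn w i
      obtain ⟨j, z, hz, hzy⟩ := Set.mem_iUnion.1 hy
      obtain rfl : sgContr j ⟨z, subset_closure (Set.mem_iUnion.2 ⟨k, hz⟩)⟩ = y := Subtype.ext hzy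
      have h1 := ih ⟨z, subset_closure (Set.mem_iUnion.2 ⟨k, hz⟩)⟩ hz (Nat.le_add_left 1 n)
        (Fin.snoc w j) j
      rw [wordMap_snoc, wordMap_snoc, sgContr_corner] at h1
      refine (abs_sub_le _ _ _).trans ((add_le_add h1 (hstep hn w i j)).trans_eq ?_)
      have : 1 - √θ ≠ 0 := by linarith
      field_simp
      ring
  have hcl : IsClosed {x : SG |
      |u (wordMap n w x) - u (wordMap n w (sgCorner i))| ≤ √M * √θ ^ n / (1 - √θ)} :=
    isClosed_le (((u.continuous.comp (continuous_wordMap n w)).sub continuous_const).abs)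
      continuous_const
  refine closure_minimal (fun y hy => ?_) hcl (dense_vertices x)
  obtain ⟨k, hk⟩ := Set.mem_iUnion.1 hy
  exact hvert k y hk hn w i

/-- The embedding of `C(K)` into `L²(K; ν)`. -/
def toL2 : C(SG, ℝ) →L[ℝ] SGL2 := ContinuousMap.toLp 2 sgMeasure ℝ

lemma toL2_injective : Function.Injective toL2 := ContinuousMap.toLp_injective sgMeasure

lemma toL2_ae_eq (u : C(SG, ℝ)) : ⇑(toL2 u) =ᵐ[sgMeasure] ⇑u := ContinuousMap.coeFn_toLp _ _

lemma exists_cell_lower_bound (n : ℕ) :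
    ∃ m : ℝ, 0 < m ∧ ∀ w, ENNReal.ofReal m ≤ sgMeasure (Set.range (wordMap n w)) := by
  obtain ⟨w, -, hw⟩ := Finset.exists_min_image Finset.univ
    (fun w : Fin n → Fin 3 => sgMeasure (Set.range (wordMap n w))) ⟨fun _ => 0, Finset.mem_univ _⟩
  refine ⟨(sgMeasure (Set.range (wordMap n w))).toReal,
    ENNReal.toReal_pos (sgMeasure_cell_pos n w).ne' (measure_ne_top _ _), fun v => ?_⟩
  rw [ENNReal.ofReal_toReal (measure_ne_top _ _)]
  exact hw v (Finset.mem_univ v)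

/-- Chebyshev's inequality in `L²`. -/
lemma le_norm_toL2 {u : C(SG, ℝ)} {a m : ℝ} (ha : 0 ≤ a) (hm : 0 ≤ m) {s : Set SG}
    (hs : ENNReal.ofReal m ≤ sgMeasure s) (h : ∀ x ∈ s, a ≤ |u x|) : a * √m ≤ ‖toL2 u‖ := by
  have h1 := Lp.mul_meas_ge_le_pow_enorm' (μ := sgMeasure) (toL2 u) (by norm_num) (by norm_num)
    (ENNReal.ofReal a)
  have h2 : sgMeasure s ≤ sgMeasure {x | ENNReal.ofReal a ≤ ‖(toL2 u : SG → ℝ) x‖ₑ} := by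
    refine measure_mono_ae ?_
    filter_upwards [toL2_ae_eq u] with x hx hxs
    change ENNReal.ofReal a ≤ ‖(toL2 u : SG → ℝ) x‖ₑ
    rw [hx, Real.enorm_eq_ofReal_abs]
    exact ENNReal.ofReal_le_ofReal (h x hxs)
  have h3 := (mul_le_mul_right (hs.trans h2) (ENNReal.ofReal a ^ (2 : ℝ≥0∞).toReal)).trans h1
  rw [ENNReal.toReal_ofNat, ENNReal.rpow_ofNat, ENNReal.rpow_ofNat, ← ENNReal.ofReal_pow ha,
    ← ENNReal.ofReal_pow (norm_nonneg _), ← ENNReal.ofReal_mul (by positivity),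
    ENNReal.ofReal_le_ofReal_iff (by positivity)] at h3
  refine le_of_sq_le_sq ?_ (norm_nonneg _)
  rwa [mul_pow, Real.sq_sqrt hm]

/-- Forms that control the decay of the level sums are coercive. -/
lemma isCoerciveAlong_of_levelSum_le {Q : ℕ → C(SG, ℝ) →ₗ[ℝ] C(SG, ℝ) →ₗ[ℝ] ℝ} {θ : ℝ}
    (hθ0 : 0 ≤ θ) (hθ1 : θ < 1)
    (h : ∀ c, ∃ M, 0 ≤ M ∧ ∀ u, (∀ n, Q n u u ≤ c) → ∀ n ≥ 1, levelSum n u ≤ M * θ ^ n) :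
    IsCoerciveAlong toL2 Q := by
  intro c ε hε
  obtain ⟨M, hM, hQ⟩ := h c
  have hρ : √θ < 1 := by rw [Real.sqrt_lt' one_pos]; simpa using hθ1
  -- At this level any two values on a cell differ by less than `ε / 2`, going through a corner. If
  -- `|u| > ε` somewhere, then `|u| ≥ ε / 2` on a whole cell, and the `L²` norm exceeds `ε / 4 *
  -- √m`.
  obtain ⟨n, hn1, hn⟩ : ∃ n, 1 ≤ n ∧ √M * √θ ^ n / (1 - √θ) < ε / 4 := by
    have h1 : Tendsto (fun n : ℕ => √M * √θ ^ n / (1 - √θ)) atTop (𝓝 0) := by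
      simpa using ((tendsto_pow_atTop_nhds_zero_of_lt_one (Real.sqrt_nonneg θ) hρ).const_mul
        √M).div_const (1 - √θ)
    exact ((eventually_ge_atTop 1).and
      (h1.eventually (gt_mem_nhds (show (0 : ℝ) < ε / 4 by positivity)))).exists
  obtain ⟨m, hm, hcell⟩ := exists_cell_lower_bound n
  refine ⟨ε / 4 * √m, by positivity, fun u hu hδ => ?_⟩
  rw [ContinuousMap.norm_le _ hε.le]
  intro x
  by_contra! hx
  obtain ⟨w, y, rfl⟩ := exists_wordMap_eq n x
  rw [Real.norm_eq_abs] at hx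
  have h2 := le_norm_toL2 (u := u) (a := ε / 2) (by positivity) hm.le (hcell w) (by
    rintro _ ⟨z, rfl⟩
    have hy := abs_sub_corner_le hM hθ0 hθ1 (hQ u hu) hn1 w 0 y
    have hz := abs_sub_corner_le hM hθ0 hθ1 (hQ u hu) hn1 w 0 z
    have h3 := abs_sub_le (u (wordMap n w y)) (u (wordMap n w (sgCorner 0))) (u (wordMap n w z))
    rw [abs_sub_comm (u (wordMap n w (sgCorner 0)))] at h3
    have h4 := abs_sub_abs_le_abs_sub (u (wordMap n w y)) (u (wordMap n w z))
    linarith)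
  have h3 : 0 < √m := Real.sqrt_pos.2 hm
  nlinarith

/-! ### The energies as suprema of quadratic forms -/

/-- The bilinear form of `levelSum n`. -/
def levelForm (n : ℕ) : C(SG, ℝ) →ₗ[ℝ] C(SG, ℝ) →ₗ[ℝ] ℝ :=
  LinearMap.mk₂ ℝ (fun u v => ∑ w : Fin n → Fin 3, ∑ i : Fin 3, ∑ j : Fin 3,
      (u (wordMap n w (sgCorner i)) - u (wordMap n w (sgCorner j))) *
        (v (wordMap n w (sgCorner i)) - v (wordMap n w (sgCorner j))))
    (fun u u' v => by
      simp only [← Finset.sum_add_distrib, ContinuousMap.add_apply]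
      congr! 3; ring)
    (fun c u v => by
      simp only [smul_eq_mul, Finset.mul_sum, ContinuousMap.smul_apply]
      congr! 3; ring)
    (fun u v v' => by
      simp only [← Finset.sum_add_distrib, ContinuousMap.add_apply]
      congr! 3; ring)
    (fun c u v => by
      simp only [smul_eq_mul, Finset.mul_sum, ContinuousMap.smul_apply]
      congr! 3; ring)

lemma levelForm_apply (n : ℕ) (u v : C(SG, ℝ)) :
    levelForm n u v = ∑ w : Fin n → Fin 3, ∑ i : Fin 3, ∑ j : Fin 3,
      (u (wordMap n w (sgCorner i)) - u (wordMap n w (sgCorner j))) *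
        (v (wordMap n w (sgCorner i)) - v (wordMap n w (sgCorner j))) := rfl

lemma levelForm_self (n : ℕ) (u : C(SG, ℝ)) : levelForm n u u = levelSum n u := by
  rw [levelForm_apply, levelSum_eq]
  simp only [sq]

lemma levelForm_comm (n : ℕ) (u v : C(SG, ℝ)) : levelForm n u v = levelForm n v u := by
  simp only [levelForm_apply, mul_comm]

lemma continuous_levelSum (n : ℕ) : Continuous (levelSum n) := by
  have h : levelSum n = fun u => ∑ w : Fin n → Fin 3, ∑ i : Fin 3, ∑ j : Fin 3,
      (u (wordMap n w (sgCorner i)) - u (wordMap n w (sgCorner j))) ^ 2 :=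
    funext (levelSum_eq n)
  rw [h]
  have he : ∀ x : SG, Continuous fun u : C(SG, ℝ) => u x := fun x =>
    continuous_eval_const x
  exact continuous_finsetSum _ fun w _ => continuous_finsetSum _ fun i _ =>
    continuous_finsetSum _ fun j _ => ((he _).sub (he _)).pow 2

/-- The forms approximating `𝓔_loc`. -/
def localSeq (n : ℕ) : C(SG, ℝ) →ₗ[ℝ] C(SG, ℝ) →ₗ[ℝ] ℝ := (5 / 3 : ℝ) ^ n • levelForm n

lemma localSeq_self (n : ℕ) (u : C(SG, ℝ)) : localSeq n u u = (5 / 3) ^ n * levelSum n u := by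
  rw [localSeq, LinearMap.smul_apply, LinearMap.smul_apply, levelForm_self, smul_eq_mul]

lemma isMonotoneFormSeq_localSeq : IsMonotoneFormSeq localSeq where
  symm n u v := by
    simp only [localSeq, LinearMap.smul_apply, levelForm_comm n u v]
  nonneg n u := by
    rw [localSeq_self]; exact mul_nonneg (by positivity) (levelSum_nonneg n u)
  mono u := by
    simp only [localSeq_self]; exact monotone_rescaled_levelSum u
  cont n := by
    simp only [localSeq_self]; exact (continuous_levelSum n).const_mul _

lemma isCoerciveAlong_localSeq : IsCoerciveAlong toL2 localSeq := by
  refine isCoerciveAlong_of_levelSum_le (θ := 3 / 5) (by norm_num) (by norm_num) fun c =>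
    ⟨|c|, abs_nonneg c, fun u hu n _ => ?_⟩
  have h1 := (hu n).trans (le_abs_self c)
  rw [localSeq_self] at h1
  have h2 : (3 / 5 : ℝ) ^ n * (5 / 3) ^ n = 1 := by rw [← mul_pow]; norm_num
  calc levelSum n u = (3 / 5) ^ n * ((5 / 3) ^ n * levelSum n u) := by rw [← mul_assoc, h2, one_mul]
    _ ≤ (3 / 5) ^ n * |c| := by gcongr
    _ = |c| * (3 / 5) ^ n := mul_comm _ _

lemma localEnergyC_eq (u : C(SG, ℝ)) : localEnergyC u = supForm localSeq u := by
  refine tendsto_nhds_unique (tendsto_localEnergyC u) ?_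
  simp only [supForm, localSeq_self]
  exact tendsto_atTop_iSup (ENNReal.ofReal_mono.comp (monotone_rescaled_levelSum u))

/-- The forms approximating `(5·2^{-β} - 1) E_β`. -/
def scaledSeq (β : ℝ) (N : ℕ) : C(SG, ℝ) →ₗ[ℝ] C(SG, ℝ) →ₗ[ℝ] ℝ :=
  ∑ k ∈ Finset.range N, ((5 * (2 : ℝ) ^ (-β) - 1) *
    (2 : ℝ) ^ ((β - hausdorffDim) * ((k + 1 : ℕ) : ℝ))) • levelForm (k + 1)

lemma scaledSeq_apply (β : ℝ) (N : ℕ) (u v : C(SG, ℝ)) :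
    scaledSeq β N u v = ∑ k ∈ Finset.range N, (5 * (2 : ℝ) ^ (-β) - 1) *
      (2 : ℝ) ^ ((β - hausdorffDim) * ((k + 1 : ℕ) : ℝ)) * levelForm (k + 1) u v := by
  simp only [scaledSeq, LinearMap.sum_apply, LinearMap.smul_apply, smul_eq_mul]

lemma scaledSeq_self (β : ℝ) (N : ℕ) (u : C(SG, ℝ)) :
    scaledSeq β N u u = ∑ k ∈ Finset.range N, (5 * (2 : ℝ) ^ (-β) - 1) *
      ((2 : ℝ) ^ ((β - hausdorffDim) * ((k + 1 : ℕ) : ℝ)) * levelSum (k + 1) u) := by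
  simp only [scaledSeq_apply, levelForm_self, mul_assoc]

lemma scale_pos {β : ℝ} (hβ : β < walkDim) : 0 < 5 * (2 : ℝ) ^ (-β) - 1 := by
  have h1 : (2 : ℝ) ^ β < 5 := by
    rw [← two_rpow_walkDim]; exact Real.rpow_lt_rpow_of_exponent_lt (by norm_num) hβ
  have h2 : (0 : ℝ) < 2 ^ β := by positivity
  rw [Real.rpow_neg (by norm_num), ← div_eq_mul_inv, sub_pos, lt_div_iff₀ h2]
  linarith

lemma scaled_term_nonneg {β : ℝ} (hβ : β < walkDim) (k : ℕ) (u : C(SG, ℝ)) :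
    0 ≤ (5 * (2 : ℝ) ^ (-β) - 1) *
      ((2 : ℝ) ^ ((β - hausdorffDim) * ((k + 1 : ℕ) : ℝ)) * levelSum (k + 1) u) :=
  mul_nonneg (scale_pos hβ).le (mul_nonneg (by positivity) (levelSum_nonneg _ _))

lemma isMonotoneFormSeq_scaledSeq {β : ℝ} (hβ : β < walkDim) :
    IsMonotoneFormSeq (scaledSeq β) where
  symm n u v := by
    simp only [scaledSeq_apply, levelForm_comm _ u v]
  nonneg n u := by
    rw [scaledSeq_self]; exact Finset.sum_nonneg fun k _ => scaled_term_nonneg hβ k u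
  mono u := by
    refine monotone_nat_of_le_succ fun n => ?_
    rw [scaledSeq_self, scaledSeq_self, Finset.sum_range_succ]
    exact le_add_of_nonneg_right (scaled_term_nonneg hβ n u)
  cont n := by
    simp only [scaledSeq_self]
    exact continuous_finsetSum _ fun k _ => ((continuous_levelSum _).const_mul _).const_mul _

/-- Each single term of the series is bounded by the whole energy. The resulting decay rate
`2^{-(β-α)}` is less than `1` because `β > α`. -/
lemma isCoerciveAlong_scaledSeq {β : ℝ} (hβ0 : hausdorffDim < β) (hβ : β < walkDim) :
    IsCoerciveAlong toL2 (scaledSeq β) := by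
  have hA := scale_pos hβ
  refine isCoerciveAlong_of_levelSum_le (θ := 2 ^ (-(β - hausdorffDim))) (by positivity)
    (Real.rpow_lt_one_of_one_lt_of_neg (by norm_num) (by linarith)) fun c =>
    ⟨|c| / (5 * (2 : ℝ) ^ (-β) - 1), by positivity, fun u hu n hn => ?_⟩
  obtain ⟨k, rfl⟩ := Nat.exists_eq_add_of_le' hn
  have h1 := (hu (k + 1)).trans (le_abs_self c)
  rw [scaledSeq_self] at h1
  have h2 := (Finset.single_le_sum (fun k _ => scaled_term_nonneg hβ k u)
    (Finset.mem_range.2 (Nat.lt_succ_self k))).trans h1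
  rw [← Real.rpow_natCast, ← Real.rpow_mul (by norm_num), neg_mul,
    Real.rpow_neg (by norm_num) ((β - hausdorffDim) * ((k + 1 : ℕ) : ℝ)), ← div_eq_mul_inv, le_div_iff₀ (by positivity), le_div_iff₀ hA]
  linarith

lemma ofReal_mul_energyC {β : ℝ} (hβ : β < walkDim) (u : C(SG, ℝ)) :
    ENNReal.ofReal (5 * (2 : ℝ) ^ (-β) - 1) * energyC β u = supForm (scaledSeq β) u := by
  rw [energyC, ← ENNReal.tsum_mul_left, ENNReal.tsum_eq_iSup_nat, supForm]
  congr 1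
  funext N
  rw [scaledSeq_self, ENNReal.ofReal_sum_of_nonneg fun k _ => scaled_term_nonneg hβ k u]
  simp only [ENNReal.ofReal_mul (scale_pos hβ).le]

/-- The chosen continuous version is `u` itself because `ν` has full support. -/
lemma extendToL2_toL2 (E : C(SG, ℝ) → ℝ≥0∞) (u : C(SG, ℝ)) : extendToL2 E (toL2 u) = E u := by
  have h : ∃ v : C(SG, ℝ), ⇑(toL2 u) =ᵐ[sgMeasure] ⇑v := ⟨u, toL2_ae_eq u⟩
  rw [extendToL2, dif_pos h]
  congr 1
  have h1 := (h.choose_spec.symm.trans (toL2_ae_eq u))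
  exact ContinuousMap.ext fun x => congrFun
    ((h.choose.continuous.ae_eq_iff_eq sgMeasure u.continuous).1 h1) x

lemma extendToL2_of_notMem_range (E : C(SG, ℝ) → ℝ≥0∞) {u : SGL2} (hu : u ∉ Set.range toL2) :
    extendToL2 E u = ⊤ := by
  rw [extendToL2, dif_neg]
  rintro ⟨v, hv⟩
  exact hu ⟨v, Lp.ext ((toL2_ae_eq v).trans hv.symm)⟩

/-! ### Abel means of monotone sequences -/

/-- The increments of a sequence, starting from `0`. -/
def increment (a : ℕ → ℝ) : ℕ → ℝ
  | 0 => a 0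
  | n + 1 => a (n + 1) - a n

lemma increment_nonneg {a : ℕ → ℝ} (ha : Monotone a) (h0 : 0 ≤ a 0) (n : ℕ) :
    0 ≤ increment a n := by
  cases n with
  | zero => exact h0
  | succ n => exact sub_nonneg.2 (ha (Nat.le_succ n))

lemma sum_increment (a : ℕ → ℝ) (n : ℕ) : ∑ j ∈ Finset.range (n + 1), increment a j = a n := by
  induction n with
  | zero => simp [increment]
  | succ n ih => rw [Finset.sum_range_succ, ih, increment]; ring

lemma tsum_abel_weights {r : ℝ} (hr0 : 0 ≤ r) (hr1 : r < 1) :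
    ∑' k : ℕ, ENNReal.ofReal ((1 - r) * r ^ k) = 1 := by
  rw [← ENNReal.ofReal_tsum_of_nonneg (fun k => mul_nonneg (by linarith) (by positivity))
    ((summable_geometric_of_lt_one hr0 hr1).mul_left _), tsum_mul_left,
    tsum_geometric_of_lt_one hr0 hr1, mul_inv_cancel₀ (by linarith), ENNReal.ofReal_one]

/-- Summation by parts for Abel means. -/
lemma tsum_abel {a : ℕ → ℝ} (ha : Monotone a) (h0 : 0 ≤ a 0) {r : ℝ} (hr0 : 0 ≤ r) (hr1 : r < 1) :
    ∑' k, ENNReal.ofReal ((1 - r) * r ^ k * a k) = ∑' j, ENNReal.ofReal (r ^ j * increment a j) := by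
  have hw : ∀ k, 0 ≤ (1 - r) * r ^ k := fun k => mul_nonneg (by linarith) (by positivity)
  have hinc := increment_nonneg ha h0
  have h1 : ∀ k, ENNReal.ofReal ((1 - r) * r ^ k * a k) = ∑' j, if j ≤ k then
      ENNReal.ofReal ((1 - r) * r ^ k) * ENNReal.ofReal (increment a j) else 0 := fun k => by
    rw [tsum_eq_sum (s := Finset.range (k + 1)) fun j hj => if_neg (by simpa using hj),
      Finset.sum_congr rfl fun j hj => if_pos (Nat.lt_succ_iff.1 (Finset.mem_range.1 hj)),
      ← Finset.mul_sum, ← ENNReal.ofReal_sum_of_nonneg fun j _ => hinc j, sum_increment,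
      ENNReal.ofReal_mul (hw k)]
  simp only [h1]
  rw [ENNReal.tsum_comm]
  congr 1
  funext j
  -- After exchanging the sums, the inner one runs over `k ≥ j`; shifting by `j` pulls out `r ^ j`
  -- and leaves Abel weights of total mass `1`.
  rw [← (add_left_injective j).tsum_eq]
  · have h2 : ∀ k, ENNReal.ofReal ((1 - r) * r ^ (k + j)) * ENNReal.ofReal (increment a j)
        = ENNReal.ofReal ((1 - r) * r ^ k) * ENNReal.ofReal (r ^ j * increment a j) := fun k => by
      rw [← ENNReal.ofReal_mul (hw _), ← ENNReal.ofReal_mul (hw _)]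
      congr 1
      ring
    simp only [le_add_iff_nonneg_left, zero_le, if_true, h2]
    rw [ENNReal.tsum_mul_right, tsum_abel_weights hr0 hr1, one_mul]
  · intro k hk
    have : j ≤ k := by
      by_contra h
      exact hk (if_neg h)
    exact ⟨k - j, Nat.sub_add_cancel this⟩

/-- After summation by parts the weights `r ^ j` increase with `r`. -/
lemma abel_mono {a : ℕ → ℝ} (ha : Monotone a) (h0 : 0 ≤ a 0) {r s : ℝ} (hr0 : 0 ≤ r) (hrs : r ≤ s)
    (hs1 : s < 1) :
    ∑' k, ENNReal.ofReal ((1 - r) * r ^ k * a k) ≤ ∑' k, ENNReal.ofReal ((1 - s) * s ^ k * a k) := by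
  rw [tsum_abel ha h0 hr0 (by linarith), tsum_abel ha h0 (by linarith) hs1]
  exact ENNReal.tsum_le_tsum fun j => ENNReal.ofReal_le_ofReal
    (mul_le_mul_of_nonneg_right (pow_le_pow_left₀ hr0 hrs j) (increment_nonneg ha h0 j))

lemma abel_le_iSup {a : ℕ → ℝ} {r : ℝ} (hr0 : 0 ≤ r) (hr1 : r < 1) :
    ∑' k, ENNReal.ofReal ((1 - r) * r ^ k * a k) ≤ ⨆ k, ENNReal.ofReal (a k) := by
  calc ∑' k, ENNReal.ofReal ((1 - r) * r ^ k * a k)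
      ≤ ∑' k, ENNReal.ofReal ((1 - r) * r ^ k) * ⨆ k, ENNReal.ofReal (a k) :=
        ENNReal.tsum_le_tsum fun k => by
          rw [ENNReal.ofReal_mul (mul_nonneg (by linarith) (by positivity))]
          gcongr
          exact le_iSup (fun k => ENNReal.ofReal (a k)) k
    _ = _ := by rw [ENNReal.tsum_mul_right, tsum_abel_weights hr0 hr1, one_mul]

/-- Keep only the increments up to `n`, whose weights are at least `r ^ n`. As `r → 1` this recovers
`a n`. -/
lemma le_abel {a : ℕ → ℝ} (ha : Monotone a) (h0 : 0 ≤ a 0) {r : ℝ} (hr0 : 0 ≤ r) (hr1 : r < 1)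
    (n : ℕ) : ENNReal.ofReal (r ^ n * a n) ≤ ∑' k, ENNReal.ofReal ((1 - r) * r ^ k * a k) := by
  have hinc := increment_nonneg ha h0
  rw [tsum_abel ha h0 hr0 hr1]
  refine le_trans ?_ (ENNReal.sum_le_tsum (Finset.range (n + 1)))
  rw [← ENNReal.ofReal_sum_of_nonneg fun j _ => mul_nonneg (by positivity) (hinc j),
    ← sum_increment a n, Finset.mul_sum]
  refine ENNReal.ofReal_le_ofReal (Finset.sum_le_sum fun j hj => ?_)
  exact mul_le_mul_of_nonneg_right
    (pow_le_pow_of_le_one hr0 hr1.le (Nat.lt_succ_iff.1 (Finset.mem_range.1 hj))) (hinc j)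

/-! ### The scaled energies as Abel means -/

/-- The ratio `2^β / 5 = 2^{β - β*}`. -/
def ratio (β : ℝ) : ℝ := 2 ^ β / 5

lemma ratio_nonneg (β : ℝ) : 0 ≤ ratio β := by unfold ratio; positivity

lemma ratio_lt_one {β : ℝ} (hβ : β < walkDim) : ratio β < 1 := by
  rw [ratio, div_lt_one (by norm_num), ← two_rpow_walkDim]
  exact Real.rpow_lt_rpow_of_exponent_lt (by norm_num) hβ

lemma ratio_mono : Monotone ratio := fun β γ h => by
  unfold ratio
  gcongr
  norm_num

lemma tendsto_ratio {β : ℕ → ℝ} (hlim : Tendsto β atTop (𝓝 walkDim)) :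
    Tendsto (fun n => ratio (β n)) atTop (𝓝 1) := by
  have h := ((Real.continuous_const_rpow (a := 2) (by norm_num)).tendsto walkDim).comp hlim
  have h2 := h.div_const 5
  rw [two_rpow_walkDim, div_self (by norm_num)] at h2
  exact h2

/-- With `r = ratio β` the prefactor is `(1 - r) / r` and the weight at level `k + 1` is
`(5r/3)^{k+1}`. Since the series starts at level `1`, the extra `r` cancels the denominator. -/
lemma scaled_energyC_eq_abel {β : ℝ} (hβ : β < walkDim) (u : C(SG, ℝ)) :
    ENNReal.ofReal (5 * (2 : ℝ) ^ (-β) - 1) * energyC β u =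
      ∑' k, ENNReal.ofReal ((1 - ratio β) * ratio β ^ k *
        ((5 / 3) ^ (k + 1) * levelSum (k + 1) u)) := by
  rw [energyC, ← ENNReal.tsum_mul_left]
  congr 1
  funext k
  rw [← ENNReal.ofReal_mul (scale_pos hβ).le]
  congr 1
  have h2 : (2 : ℝ) ^ β ≠ 0 := by positivity
  rw [Real.rpow_mul (by norm_num), Real.rpow_natCast, Real.rpow_sub (by norm_num),
    two_rpow_hausdorffDim, Real.rpow_neg (by norm_num), ratio, ← mul_assoc, ← mul_assoc]
  congr 1
  have h3 : (2 : ℝ) ^ β / 3 = 2 ^ β / 5 * (5 / 3) := by ring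
  rw [h3, mul_pow, ← mul_assoc]
  congr 1
  rw [pow_succ]
  field_simp

lemma monotone_shift (u : C(SG, ℝ)) :
    Monotone fun k : ℕ => (5 / 3 : ℝ) ^ (k + 1) * levelSum (k + 1) u :=
  (monotone_rescaled_levelSum u).comp fun _ _ h => Nat.succ_le_succ h

lemma shift_zero_nonneg (u : C(SG, ℝ)) : 0 ≤ (5 / 3 : ℝ) ^ (0 + 1) * levelSum (0 + 1) u :=
  mul_nonneg (by positivity) (levelSum_nonneg _ _)

lemma localEnergyC_eq_iSup (u : C(SG, ℝ)) :
    localEnergyC u = ⨆ k : ℕ, ENNReal.ofReal ((5 / 3) ^ (k + 1) * levelSum (k + 1) u) :=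
  tendsto_nhds_unique ((tendsto_localEnergyC u).comp (tendsto_add_atTop_nat 1))
    (tendsto_atTop_iSup (ENNReal.ofReal_mono.comp (monotone_shift u)))

lemma scaled_energy_mono {β γ : ℝ} (hβγ : β ≤ γ) (hγ : γ < walkDim) (u : SGL2) :
    ENNReal.ofReal (5 * (2 : ℝ) ^ (-β) - 1) * energy β u ≤
      ENNReal.ofReal (5 * (2 : ℝ) ^ (-γ) - 1) * energy γ u := by
  by_cases hu : u ∈ Set.range toL2
  · obtain ⟨x, rfl⟩ := hu
    rw [energy, energy, extendToL2_toL2, extendToL2_toL2,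
      scaled_energyC_eq_abel (hβγ.trans_lt hγ), scaled_energyC_eq_abel hγ]
    exact abel_mono (monotone_shift x) (shift_zero_nonneg x) (ratio_nonneg β) (ratio_mono hβγ)
      (ratio_lt_one hγ)
  · rw [energy, energy, extendToL2_of_notMem_range _ hu, extendToL2_of_notMem_range _ hu,
      -- Strict positivity of the prefactor is essential, since `0 * ⊤ = 0` in `ℝ≥0∞`.
      ENNReal.mul_top (ENNReal.ofReal_pos.2 (scale_pos hγ)).ne']
    exact le_top

lemma scaled_energy_le_localEnergy {β : ℝ} (hβ : β < walkDim) (u : SGL2) :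
    ENNReal.ofReal (5 * (2 : ℝ) ^ (-β) - 1) * energy β u ≤ localEnergy u := by
  by_cases hu : u ∈ Set.range toL2
  · obtain ⟨x, rfl⟩ := hu
    rw [energy, localEnergy, extendToL2_toL2, extendToL2_toL2, scaled_energyC_eq_abel hβ,
      localEnergyC_eq_iSup]
    exact abel_le_iSup (ratio_nonneg β) (ratio_lt_one hβ)
  · rw [localEnergy, extendToL2_of_notMem_range _ hu]
    exact le_top

/-- For fixed `k` the lower bound `r^k * a k ≤ L` survives the limit `r → 1`; the supremum over `k`
comes last. -/
lemma localEnergy_le {β : ℕ → ℝ} (hβ : ∀ n, β n < walkDim) (hlim : Tendsto β atTop (𝓝 walkDim))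
    {u : SGL2} {L : ℝ≥0∞}
    (h : ∀ n, ENNReal.ofReal (5 * (2 : ℝ) ^ (-β n) - 1) * energy (β n) u ≤ L) :
    localEnergy u ≤ L := by
  by_cases hu : u ∈ Set.range toL2
  · obtain ⟨x, rfl⟩ := hu
    rw [localEnergy, extendToL2_toL2, localEnergyC_eq_iSup]
    refine iSup_le fun k => ?_
    have h1 := ((tendsto_ratio hlim).pow k).mul_const ((5 / 3) ^ (k + 1) * levelSum (k + 1) x)
    rw [one_pow, one_mul] at h1
    refine le_of_tendsto' (ENNReal.tendsto_ofReal h1) fun n => le_trans ?_ (h n)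
    rw [energy, extendToL2_toL2, scaled_energyC_eq_abel (hβ n)]
    exact le_abel (monotone_shift x) (shift_zero_nonneg x) (ratio_nonneg _) (ratio_lt_one (hβ n)) k
  · have h0 := h 0
    rw [energy, extendToL2_of_notMem_range _ hu,
      ENNReal.mul_top (ENNReal.ofReal_pos.2 (scale_pos (hβ 0))).ne'] at h0
    exact le_top.trans h0

lemma scaled_energy_toL2 {β : ℝ} (hβ : β < walkDim) (x : C(SG, ℝ)) :
    ENNReal.ofReal (5 * (2 : ℝ) ^ (-β) - 1) * energy β (toL2 x) = supForm (scaledSeq β) x := by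
  rw [energy, extendToL2_toL2, ofReal_mul_energyC hβ]

lemma scaled_energy_of_notMem_range {β : ℝ} (hβ : β < walkDim) (u : SGL2)
    (hu : u ∉ Set.range toL2) :
    ENNReal.ofReal (5 * (2 : ℝ) ^ (-β) - 1) * energy β u = ⊤ := by
  rw [energy, extendToL2_of_notMem_range _ hu,
    ENNReal.mul_top (ENNReal.ofReal_pos.2 (scale_pos hβ)).ne']

end SierpinskiGasket

end

theorem mainTheorem3 (β : ℕ → ℝ)
    (hβ : ∀ n, β n ∈ Set.Ioo SierpinskiGasket.hausdorffDim SierpinskiGasket.walkDim)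
    (hmono : Monotone β)
    (hlim : Tendsto β atTop (𝓝 SierpinskiGasket.walkDim)) :
    SierpinskiGasket.MoscoConverges
      (fun n u => ENNReal.ofReal (5 * (2 : ℝ) ^ (-β n) - 1) * SierpinskiGasket.energy (β n) u)
      SierpinskiGasket.localEnergy := by
  open SierpinskiGasket in
  refine ⟨fun n => ?_, ?_, fun u v huv => ?_, fun v => ⟨fun _ => v, tendsto_const_nhds, ?_⟩⟩
  · exact (isMonotoneFormSeq_scaledSeq (hβ n).2).isClosedForm
      (isCoerciveAlong_scaledSeq (hβ n).1 (hβ n).2) toL2_injective (scaled_energy_toL2 (hβ n).2)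
      (scaled_energy_of_notMem_range (hβ n).2)
  · exact isMonotoneFormSeq_localSeq.isClosedForm isCoerciveAlong_localSeq toL2_injective
      (fun x => by rw [localEnergy, extendToL2_toL2, localEnergyC_eq])
      (fun u hu => extendToL2_of_notMem_range _ hu)
  -- With `m` frozen, weak lower semicontinuity applies to a single form; monotonicity in `β` then
  -- replaces it by the `n`-th form for all `n ≥ m`.
  · refine localEnergy_le (fun n => (hβ n).2) hlim fun m => ?_
    refine ((isMonotoneFormSeq_scaledSeq (hβ m).2).le_liminf_of_tendsto_weak
      (isCoerciveAlong_scaledSeq (hβ m).1 (hβ m).2) (scaled_energy_toL2 (hβ m).2)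
      (scaled_energy_of_notMem_range (hβ m).2) huv).trans ?_
    exact liminf_le_liminf ((eventually_ge_atTop m).mono fun n hn =>
      scaled_energy_mono (hmono hn) (hβ n).2 (u n))
  · exact limsup_le_of_le (by isBoundedDefault) (Eventually.of_forall fun n =>
      scaled_energy_le_localEnergy (hβ n).2 v)
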